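/- Let $a<b$ be real numbers, $1\le p\le\infty$, $n\in\mathbb N\cup\{0\}$ and $m,r,l\in\mathbb N=\{1,2,\dots\}$. Put $W_p^0=L_p([a,b];\mathbb C)$ and, for $s\ge 1$, $$W_p^{s}=\{y\in C^{s-1}([a,b];\mathbb C):\ y^{(s-1)}\in AC[a,b],\ y^{(s)}\in L_p[a,b]\},\qquad \|y\|_{s,p}=\sum_{j=0}^{s}\|y^{(j)}\|_p,$$ and let $(W_p^s)^m$ and $(W_p^s)^{m\times m}$ be the spaces of vector- and matrix-valued functions with components in $W_p^s$, normed by the sum of the norms of the components. Given matrix-valued functions $A_0,\dots,A_{r-1}\in(W_p^n)^{m\times m}$ and a continuous linear operator $B:(W_p^{n+r})^m\to\mathbb C^l$, consider the linear operator $$(L,B):(W_p^{n+r})^m\to(W_p^n)^m\times\mathbb C^l,\qquad (L,B)y=(Ly,By),\qquad Ly=y^{(r)}+\sum_{j=1}^{r}A_{r-j}\,y^{(r-j)}.$$ For every $k\in\mathbb N$ let $(L(k),B(k))$ be an operator of the same form (with the same $a,b,p,n,m,r,l$), given by coefficients $A_{r-j}(\cdot,k)\in(W_p^n)^{m\times m}$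 and a continuous linear operator $B(k):(W_p^{n+r})^m\to\mathbb C^l$. Suppose that $(L(k),B(k))$ converges strongly to $(L,B)$ as $k\to\infty$, i.e. $(L(k),B(k))y\to(L,B)y$ in $(W_p^n)^m\times\mathbb C^l$ for every $y\in(W_p^{n+r})^m$. Then, for all sufficiently large $k$, $$\dim\ker(L(k),B(k))\le\dim\ker(L,B)\quad\text{and}\quad\dim\operatorname{coker}(L(k),B(k))\le\dim\operatorname{coker}(L,B),$$ where $\operatorname{coker}T=E_2/T(E_1)$ for a linear operator $T:E_1\to E_2$. -/

import Mathlib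

open MeasureTheory Set Filter Topology
open scoped ENNReal

namespace SobolevBVP

/-- A function `y : ℝ → ℂ`, regarded only on `[a, b]`, is of Sobolev class `W_p^s([a, b]; ℂ)`:
for `s = 0` this means `y ∈ L_p`, and for `s + 1` it means that `y ∈ C^s([a, b])`, that `y^(s)` is
absolutely continuous on `[a, b]`, and that `y^(s+1) ∈ L_p`. Derivatives are taken within `[a, b]`
(hence one-sided at the endpoints). -/
def MemSobolev (a b : ℝ) (p : ℝ≥0∞) : ℕ → (ℝ → ℂ) → Prop
  | 0, y => MemLp y p (volume.restrict (Icc a b))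
  | s + 1, y =>
      ContDiffOn ℝ s y (Icc a b) ∧
      AbsolutelyContinuousOnInterval (iteratedDerivWithin s y (Icc a b)) a b ∧
      MemLp (iteratedDerivWithin (s + 1) y (Icc a b)) p (volume.restrict (Icc a b))

section Aux

variable {a b : ℝ} {p : ℝ≥0∞} {s n : ℕ} {f g y : ℝ → ℂ}

theorem ac_congr (hab : a < b) (h : EqOn f g (Icc a b))
    (hf : AbsolutelyContinuousOnInterval f a b) : AbsolutelyContinuousOnInterval g a b := by
  rw [absolutelyContinuousOnInterval_iff] at hf ⊢
  intro ε hε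
  obtain ⟨δ, hδ, H⟩ := hf ε hε
  refine ⟨δ, hδ, fun E hE hlt => ?_⟩
  have := H E hE hlt
  rw [← uIcc_of_le hab.le] at h
  convert this using 1
  refine Finset.sum_congr rfl fun i hi => ?_
  rw [h (hE.1 i hi).1, h (hE.1 i hi).2]

theorem ac_ae_diff (hab : a < b) (hf : AbsolutelyContinuousOnInterval f a b) :
    ∀ᵐ x ∂volume.restrict (Icc a b), DifferentiableWithinAt ℝ f (Icc a b) x := by
  have h := hf.boundedVariationOn
  rw [uIcc_of_le hab.le] at h
  exact h.locallyBoundedVariationOn.ae_differentiableWithinAt measurableSet_Icc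

theorem memLp_of_continuousOn (hf : ContinuousOn f (Icc a b)) :
    MemLp f p (volume.restrict (Icc a b)) := by
  obtain ⟨C, hC⟩ := isCompact_Icc.exists_bound_of_continuousOn hf
  refine MemLp.of_bound (hf.aestronglyMeasurable measurableSet_Icc) C ?_
  filter_upwards [ae_restrict_mem measurableSet_Icc] with x hx using hC x hx

theorem ac_of_contDiffOn (hab : a < b) (hf : ContDiffOn ℝ 1 f (Icc a b)) :
    AbsolutelyContinuousOnInterval f a b := by
  rw [← uIcc_of_le hab.le] at hf
  exact hf.absolutelyContinuousOnInterval

theorem ac_continuousOn (hab : a < b) (hf : AbsolutelyContinuousOnInterval f a b) :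
    ContinuousOn f (Icc a b) := by
  have := hf.continuousOn
  rwa [uIcc_of_le hab.le] at this

namespace MemSobolev

theorem continuousOn (hy : MemSobolev a b p (s + 1) y) : ContinuousOn y (Icc a b) :=
  hy.1.continuousOn

theorem succ_succ_iff (hab : a < b) : MemSobolev a b p (s + 2) y ↔
    DifferentiableOn ℝ y (Icc a b) ∧ MemSobolev a b p (s + 1) (derivWithin y (Icc a b)) := by
  have h : ContDiffOn ℝ ((s + 1 : ℕ) : WithTop ℕ∞) y (Icc a b) ↔ DifferentiableOn ℝ y (Icc a b) ∧
      ContDiffOn ℝ s (derivWithin y (Icc a b)) (Icc a b) := by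
    have := contDiffOn_succ_iff_derivWithin (n := (s : WithTop ℕ∞)) (f := y)
      (uniqueDiffOn_Icc hab)
    push_cast
    simpa using this
  simp only [MemSobolev, h, iteratedDerivWithin_succ' (f := y), and_assoc]

theorem memLp_iteratedDerivWithin (hab : a < b) (hy : MemSobolev a b p s y) {j : ℕ} (hj : j ≤ s) :
    MemLp (iteratedDerivWithin j y (Icc a b)) p (volume.restrict (Icc a b)) := by
  cases s with
  | zero =>
    obtain rfl : j = 0 := by omega
    simpa [MemSobolev] using hy
  | succ s =>
    rcases Nat.lt_or_ge s j with h | h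
    · obtain rfl : j = s + 1 := by omega
      exact hy.2.2
    · exact memLp_of_continuousOn
        (hy.1.continuousOn_iteratedDerivWithin (by exact_mod_cast h) (uniqueDiffOn_Icc hab))

theorem congr (hab : a < b) (h : EqOn f g (Icc a b)) (hf : MemSobolev a b p s f) :
    MemSobolev a b p s g := by
  cases s with
  | zero =>
    refine MemLp.ae_eq ?_ hf
    filter_upwards [ae_restrict_mem measurableSet_Icc] with x hx using h hx
  | succ s =>
    refine ⟨hf.1.congr fun x hx => (h hx).symm, ac_congr hab (iteratedDerivWithin_congr h) hf.2.1,
      MemLp.ae_eq ?_ hf.2.2⟩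
    filter_upwards [ae_restrict_mem measurableSet_Icc] with x hx
      using iteratedDerivWithin_congr h hx

/-- Two functions of Sobolev class that agree almost everywhere have the same derivatives. -/
theorem ae_congr (hab : a < b) (hf : MemSobolev a b p s f) (hg : MemSobolev a b p s g)
    (h : f =ᵐ[volume.restrict (Icc a b)] g) {j : ℕ} (hj : j ≤ s) :
    iteratedDerivWithin j f (Icc a b) =ᵐ[volume.restrict (Icc a b)]
      iteratedDerivWithin j g (Icc a b) := by
  cases s with
  | zero =>
    obtain rfl : j = 0 := by omega
    simpa using h
  | succ s =>
    have h' := Measure.eqOn_Icc_of_ae_eq volume hab.ne h hf.continuousOn hg.continuousOn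
    filter_upwards [ae_restrict_mem measurableSet_Icc] with x hx
      using iteratedDerivWithin_congr h' hx

theorem ae_add (hab : a < b) (hf : MemSobolev a b p s f) (hg : MemSobolev a b p s g)
    {j : ℕ} (hj : j ≤ s) :
    iteratedDerivWithin j (f + g) (Icc a b) =ᵐ[volume.restrict (Icc a b)]
      iteratedDerivWithin j f (Icc a b) + iteratedDerivWithin j g (Icc a b) := by
  cases s with
  | zero =>
    obtain rfl : j = 0 := by omega
    simp
  | succ s =>
    have key : ∀ i ≤ s, EqOn (iteratedDerivWithin i (f + g) (Icc a b))
        (iteratedDerivWithin i f (Icc a b) + iteratedDerivWithin i g (Icc a b)) (Icc a b) :=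
      fun i hi x hx => iteratedDerivWithin_add hx (uniqueDiffOn_Icc hab)
        ((hf.1 x hx).of_le (by exact_mod_cast hi)) ((hg.1 x hx).of_le (by exact_mod_cast hi))
    rcases Nat.lt_or_ge s j with h | h
    · obtain rfl : j = s + 1 := by omega
      filter_upwards [ae_restrict_mem measurableSet_Icc, ac_ae_diff hab hf.2.1,
        ac_ae_diff hab hg.2.1] with x hx h1 h2
      rw [Pi.add_apply, iteratedDerivWithin_succ, iteratedDerivWithin_succ,
        iteratedDerivWithin_succ, derivWithin_congr (key s le_rfl) (key s le_rfl hx),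
        derivWithin_add h1 h2]
    · filter_upwards [ae_restrict_mem measurableSet_Icc] with x hx using key j h hx

theorem add (hab : a < b) (hf : MemSobolev a b p s f) (hg : MemSobolev a b p s g) :
    MemSobolev a b p s (f + g) := by
  cases s with
  | zero => exact MemLp.add hf hg
  | succ s =>
    refine ⟨hf.1.add hg.1, ac_congr hab (fun x hx => ?_) (hf.2.1.add hg.2.1),
      MemLp.ae_eq (ae_add hab hf hg le_rfl).symm (hf.2.2.add hg.2.2)⟩
    exact (iteratedDerivWithin_add hx (uniqueDiffOn_Icc hab) (hf.1 x hx) (hg.1 x hx)).symm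

theorem const_smul (c : ℂ) (hf : MemSobolev a b p s f) : MemSobolev a b p s (c • f) := by
  have key : ∀ i, iteratedDerivWithin i (c • f) (Icc a b)
      = c • iteratedDerivWithin i f (Icc a b) := fun i => by
    ext x; simp
  cases s with
  | zero => exact MemLp.const_smul hf c
  | succ s =>
    refine ⟨hf.1.const_smul c, ?_, ?_⟩
    · rw [key]; exact hf.2.1.const_smul c
    · rw [key]; exact hf.2.2.const_smul c

theorem zero : MemSobolev a b p s 0 := by
  have key : ∀ i, iteratedDerivWithin i (0 : ℝ → ℂ) (Icc a b) = 0 := fun _ =>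
    funext fun _ => iteratedDerivWithin_const_zero
  cases s with
  | zero => exact MemLp.zero
  | succ s =>
    refine ⟨contDiffOn_const, ?_, ?_⟩
    · rw [key]
      simpa using! (AbsolutelyContinuousOnInterval.const_smul (0 : ℝ)
        (ContDiffOn.absolutelyContinuousOnInterval (a := a) (b := b)
          (f := (0 : ℝ → ℂ)) contDiffOn_const))
    · rw [key]; exact MemLp.zero

theorem sum (hab : a < b) {ι : Type*} (t : Finset ι) {F : ι → ℝ → ℂ}
    (h : ∀ i ∈ t, MemSobolev a b p s (F i)) : MemSobolev a b p s (∑ i ∈ t, F i) := by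
  classical
  induction t using Finset.induction_on with
  | empty => simpa using zero
  | insert i t hi ih =>
    rw [Finset.sum_insert hi]
    exact add hab (h i (by simp)) (ih fun j hj => h j (by simp [hj]))

theorem of_succ (hab : a < b) (hf : MemSobolev a b p (s + 1) f) : MemSobolev a b p s f := by
  induction s generalizing f with
  | zero => exact memLp_of_continuousOn hf.continuousOn
  | succ s ih =>
    cases s with
    | zero =>
      refine ⟨hf.1.of_le (by norm_num), ?_, ?_⟩
      · simpa using ac_of_contDiffOn hab (by simpa using hf.1)
      · exact memLp_iteratedDerivWithin hab hf (by norm_num)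
    | succ s =>
      rw [succ_succ_iff hab] at hf ⊢
      exact ⟨hf.1, ih hf.2⟩

theorem iteratedDerivWithin (hab : a < b) {j : ℕ} (hf : MemSobolev a b p (s + j) f) :
    MemSobolev a b p s (iteratedDerivWithin j f (Icc a b)) := by
  induction j generalizing f with
  | zero => simpa using hf
  | succ j ih =>
    rw [iteratedDerivWithin_succ']
    apply ih
    rcases Nat.eq_zero_or_pos (s + j) with h | h
    · have := hf.memLp_iteratedDerivWithin hab (j := 1) (by omega)
      rw [iteratedDerivWithin_one] at this
      rw [h]
      exact this
    · obtain ⟨q, hq⟩ : ∃ q, s + j = q + 1 := ⟨s + j - 1, by omega⟩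
      rw [show s + (j + 1) = q + 2 by omega, succ_succ_iff hab] at hf
      rw [hq]
      exact hf.2

theorem mono (hab : a < b) {j : ℕ} (hf : MemSobolev a b p (s + j) f) : MemSobolev a b p s f := by
  induction j with
  | zero => exact hf
  | succ j ih => exact ih (of_succ hab hf)

theorem memLp_mul (hf : MemLp f p (volume.restrict (Icc a b))) (hg : ContinuousOn g (Icc a b)) :
    MemLp (f * g) p (volume.restrict (Icc a b)) := by
  exact MemLp.mul (p := p) (q := ∞) (r := p) (memLp_of_continuousOn hg) hf

theorem mul (hab : a < b) (hf : MemSobolev a b p s f) (hg : MemSobolev a b p (s + 1) g) :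
    MemSobolev a b p s (f * g) := by
  cases s with
  | zero => exact memLp_mul hf hg.continuousOn
  | succ s =>
    replace hg := of_succ hab hg
    induction s generalizing f g with
    | zero =>
      have hf1 : AbsolutelyContinuousOnInterval f a b := by simpa using hf.2.1
      have hg1 : AbsolutelyContinuousOnInterval g a b := by simpa using hg.2.1
      have hf2 : MemLp (derivWithin f (Icc a b)) p (volume.restrict (Icc a b)) := by
        simpa [iteratedDerivWithin_one] using hf.2.2
      have hg2 : MemLp (derivWithin g (Icc a b)) p (volume.restrict (Icc a b)) := by
        simpa [iteratedDerivWithin_one] using hg.2.2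
      refine ⟨hf.1.mul hg.1, ?_, ?_⟩
      · simpa using! hf1.smul hg1
      · have := (memLp_mul hf2 hg.continuousOn).add (memLp_mul hg2 hf.continuousOn)
        refine this.ae_eq ?_
        filter_upwards [ac_ae_diff hab hf1, ac_ae_diff hab hg1] with x h1 h2
        rw [zero_add, iteratedDerivWithin_one, derivWithin_mul h1 h2]
        simp only [Pi.add_apply, Pi.mul_apply]
        ring
    | succ s ih =>
      have hf0 := of_succ hab hf
      have hg0 := of_succ hab hg
      rw [succ_succ_iff hab] at hf hg ⊢
      refine ⟨hf.1.mul hg.1, congr hab (fun x hx => ?_)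
        (add hab (ih hf.2 hg0) (ih hf0 hg.2))⟩
      rw [derivWithin_mul (hf.1 x hx) (hg.1 x hx)]
      rfl

end MemSobolev

end Aux

/-- The Sobolev space `W_p^s([a, b]; ℂ)` as a subspace: a function `y` of Sobolev class is
recorded as the tuple `(y, y', …, y^(s))` of the classes of its derivatives in `L_p`.
With the norm induced from the `ℓ¹`-product of `s + 1` copies of `L_p`, the norm of `y` is
`‖y‖_p + ‖y'‖_p + … + ‖y^(s)‖_p`. -/
def sobolevSubmodule (a b : ℝ) [hab : Fact (a < b)] (p : ℝ≥0∞) [Fact (1 ≤ p)] (s : ℕ) :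
    Submodule ℂ (PiLp 1 (fun _ : Fin (s + 1) => Lp ℂ p (volume.restrict (Icc a b)))) where
  carrier := {F | ∃ y : ℝ → ℂ, MemSobolev a b p s y ∧
    ∀ j : Fin (s + 1), F j =ᵐ[volume.restrict (Icc a b)] iteratedDerivWithin j y (Icc a b)}
  add_mem' := by
    rintro F G ⟨y, hy, hF⟩ ⟨z, hz, hG⟩
    refine ⟨y + z, hy.add hab.out hz, fun j => ?_⟩
    filter_upwards [Lp.coeFn_add (F j) (G j), hF j, hG j,
      MemSobolev.ae_add hab.out hy hz (Nat.le_of_lt_succ j.2)] with x h1 h2 h3 h4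
    rw [PiLp.add_apply, h1, h4, Pi.add_apply, Pi.add_apply, h2, h3]
  zero_mem' := by
    refine ⟨0, MemSobolev.zero, fun j => ?_⟩
    have h : iteratedDerivWithin j (0 : ℝ → ℂ) (Icc a b) = 0 :=
      funext fun _ => iteratedDerivWithin_const_zero
    rw [h]
    exact Lp.coeFn_zero _ _ _
  smul_mem' := by
    rintro c F ⟨y, hy, hF⟩
    refine ⟨c • y, hy.const_smul c, fun j => ?_⟩
    filter_upwards [Lp.coeFn_smul c (F j), hF j] with x h1 h2
    rw [PiLp.smul_apply, h1, Pi.smul_apply, h2, iteratedDerivWithin_const_smul_field]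

/-- The Sobolev space `W_p^s([a, b]; ℂ)`. -/
def SobolevSpace (a b : ℝ) [Fact (a < b)] (p : ℝ≥0∞) [Fact (1 ≤ p)] (s : ℕ) : Type :=
  sobolevSubmodule a b p s

noncomputable instance (a b : ℝ) [Fact (a < b)] (p : ℝ≥0∞) [Fact (1 ≤ p)] (s : ℕ) :
    NormedAddCommGroup (SobolevSpace a b p s) :=
  inferInstanceAs (NormedAddCommGroup (sobolevSubmodule a b p s))

noncomputable instance (a b : ℝ) [Fact (a < b)] (p : ℝ≥0∞) [Fact (1 ≤ p)] (s : ℕ) :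
    NormedSpace ℂ (SobolevSpace a b p s) :=
  inferInstanceAs (NormedSpace ℂ (sobolevSubmodule a b p s))

namespace SobolevSpace

variable {a b : ℝ} [hab : Fact (a < b)] {p : ℝ≥0∞} [Fact (1 ≤ p)] {s : ℕ}

/-- The element of the Sobolev space given by a function of Sobolev class. -/
noncomputable def mk (y : ℝ → ℂ) (hy : MemSobolev a b p s y) : SobolevSpace a b p s :=
  ⟨WithLp.toLp 1 fun j : Fin (s + 1) =>
      (hy.memLp_iteratedDerivWithin hab.out (Nat.le_of_lt_succ j.2)).toLp _,
    y, hy, fun j => MemLp.coeFn_toLp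
      (hy.memLp_iteratedDerivWithin hab.out (Nat.le_of_lt_succ j.2))⟩

/-- A function of Sobolev class representing an element of the Sobolev space. It is determined
almost everywhere on `[a, b]`, and everywhere on `[a, b]` if `s ≥ 1`. -/
noncomputable def fn (F : SobolevSpace a b p s) : ℝ → ℂ := F.2.choose

theorem memSobolev_fn (F : SobolevSpace a b p s) : MemSobolev a b p s F.fn := F.2.choose_spec.1

theorem ae_eq_fn (F : SobolevSpace a b p s) (j : Fin (s + 1)) :
    F.1 j =ᵐ[volume.restrict (Icc a b)] iteratedDerivWithin j F.fn (Icc a b) :=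
  F.2.choose_spec.2 j

theorem norm_eq (F : SobolevSpace a b p s) :
    ‖F‖ = ∑ j : Fin (s + 1), (eLpNorm (iteratedDerivWithin j F.fn (Icc a b)) p
      (volume.restrict (Icc a b))).toReal := by
  change ‖F.1‖ = _
  rw [PiLp.norm_eq_of_L1]
  refine Finset.sum_congr rfl fun j _ => ?_
  rw [Lp.norm_def, eLpNorm_congr_ae (F.ae_eq_fn j)]

theorem fn_mk (y : ℝ → ℂ) (hy : MemSobolev a b p s y) :
    (mk y hy).fn =ᵐ[volume.restrict (Icc a b)] y := by
  have h1 := (mk y hy).ae_eq_fn 0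
  have h2 : (mk y hy).1 0 =ᵐ[volume.restrict (Icc a b)] iteratedDerivWithin 0 y (Icc a b) :=
    MemLp.coeFn_toLp (hy.memLp_iteratedDerivWithin hab.out (Nat.zero_le s))
  simpa using h1.symm.trans h2

/-- An element of the Sobolev space is determined by its underlying function. -/
theorem ext_fn {F G : SobolevSpace a b p s} (h : F.fn =ᵐ[volume.restrict (Icc a b)] G.fn) :
    F = G := by
  apply Subtype.ext
  refine PiLp.ext fun j => Lp.ext ?_
  exact (F.ae_eq_fn j).trans ((MemSobolev.ae_congr hab.out F.memSobolev_fn G.memSobolev_fn h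
    (Nat.le_of_lt_succ j.2)).trans (G.ae_eq_fn j).symm)

theorem deriv_fn_add (F G : SobolevSpace a b p s) (j : ℕ) (hj : j ≤ s) :
    iteratedDerivWithin j (F + G).fn (Icc a b) =ᵐ[volume.restrict (Icc a b)]
      iteratedDerivWithin j F.fn (Icc a b) + iteratedDerivWithin j G.fn (Icc a b) := by
  let i : Fin (s + 1) := ⟨j, Nat.lt_succ_of_le hj⟩
  have h : ((F + G).1 i : ℝ → ℂ) =ᵐ[volume.restrict (Icc a b)] F.1 i + G.1 i :=
    Lp.coeFn_add (F.1 i) (G.1 i)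
  exact ((F + G).ae_eq_fn i).symm.trans (h.trans ((F.ae_eq_fn i).add (G.ae_eq_fn i)))

theorem deriv_fn_smul (c : ℂ) (F : SobolevSpace a b p s) (j : ℕ) (hj : j ≤ s) :
    iteratedDerivWithin j (c • F).fn (Icc a b) =ᵐ[volume.restrict (Icc a b)]
      c • iteratedDerivWithin j F.fn (Icc a b) := by
  let i : Fin (s + 1) := ⟨j, Nat.lt_succ_of_le hj⟩
  have h : ((c • F).1 i : ℝ → ℂ) =ᵐ[volume.restrict (Icc a b)] c • F.1 i :=
    Lp.coeFn_smul c (F.1 i)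
  exact ((c • F).ae_eq_fn i).symm.trans (h.trans ((F.ae_eq_fn i).const_smul c))

end SobolevSpace

/-- The space `(W_p^s)^m = W_p^s([a, b]; ℂ^m)`, normed by the sum of the norms of the `m`
components. -/
abbrev SobolevVec (a b : ℝ) [Fact (a < b)] (p : ℝ≥0∞) [Fact (1 ≤ p)] (s m : ℕ) : Type :=
  PiLp 1 (fun _ : Fin m => SobolevSpace a b p s)

section Operator

variable {a b : ℝ} [hab : Fact (a < b)] {p : ℝ≥0∞} [Fact (1 ≤ p)] {n m r l : ℕ}

/-- The `i`-th component of `y^(r)(t) + ∑_{j < r} A_j(t) y^(j)(t)`. -/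
noncomputable def diffExpr (A : Fin r → Matrix (Fin m) (Fin m) (SobolevSpace a b p n))
    (y : SobolevVec a b p (n + r) m) (i : Fin m) (t : ℝ) : ℂ :=
  iteratedDerivWithin r (y i).fn (Icc a b) t +
    ∑ j : Fin r, ∑ q : Fin m, (A j i q).fn t * iteratedDerivWithin j (y q).fn (Icc a b) t

theorem memSobolev_diffExpr (A : Fin r → Matrix (Fin m) (Fin m) (SobolevSpace a b p n))
    (y : SobolevVec a b p (n + r) m) (i : Fin m) : MemSobolev a b p n (diffExpr A y i) := by
  have h : diffExpr A y i = iteratedDerivWithin r (y i).fn (Icc a b) +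
      ∑ j : Fin r, ∑ q : Fin m, (A j i q).fn * iteratedDerivWithin j (y q).fn (Icc a b) := by
    ext t
    simp [diffExpr]
  rw [h]
  refine MemSobolev.add hab.out (MemSobolev.iteratedDerivWithin hab.out (y i).memSobolev_fn)
    (MemSobolev.sum hab.out _ fun j _ => MemSobolev.sum hab.out _ fun q _ =>
      MemSobolev.mul hab.out (A j i q).memSobolev_fn
        (MemSobolev.iteratedDerivWithin hab.out ?_))
  refine MemSobolev.mono hab.out (j := r - 1 - j) ?_
  have := (y q).memSobolev_fn
  rwa [show n + 1 + (j : ℕ) + (r - 1 - j) = n + r by have := j.2; omega]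

/-- The differential operator `L : (W_p^{n+r})^m → (W_p^n)^m`,
`L y = y^(r) + ∑_{j < r} A_j y^(j)`. -/
noncomputable def diffOp (A : Fin r → Matrix (Fin m) (Fin m) (SobolevSpace a b p n)) :
    SobolevVec a b p (n + r) m →ₗ[ℂ] SobolevVec a b p n m where
  toFun y := WithLp.toLp 1 fun i => SobolevSpace.mk (diffExpr A y i) (memSobolev_diffExpr A y i)
  map_add' y z := by
    refine PiLp.ext fun i => SobolevSpace.ext_fn ?_
    refine (SobolevSpace.fn_mk _ (memSobolev_diffExpr A (y + z) i)).trans ?_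
    refine EventuallyEq.trans ?_ (SobolevSpace.deriv_fn_add
      (SobolevSpace.mk _ (memSobolev_diffExpr A y i))
      (SobolevSpace.mk _ (memSobolev_diffExpr A z i)) 0 (Nat.zero_le _)).symm
    simp only [iteratedDerivWithin_zero]
    refine EventuallyEq.trans ?_
      ((SobolevSpace.fn_mk _ (memSobolev_diffExpr A y i)).add
        (SobolevSpace.fn_mk _ (memSobolev_diffExpr A z i))).symm
    have h1 : ∀ j : Fin (r + 1), ∀ q : Fin m, ∀ᵐ t ∂volume.restrict (Icc a b),
        iteratedDerivWithin j ((y + z) q).fn (Icc a b) t =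
          iteratedDerivWithin j (y q).fn (Icc a b) t +
          iteratedDerivWithin j (z q).fn (Icc a b) t := fun j q =>
      SobolevSpace.deriv_fn_add (y q) (z q) j (by have := j.2; omega)
    filter_upwards [ae_all_iff.2 fun j => ae_all_iff.2 (h1 j)] with t ht
    have hr := ht (Fin.last r) i
    simp only [Fin.val_last] at hr
    have hj : ∀ (j : Fin r) (q : Fin m), iteratedDerivWithin j ((y + z) q).fn (Icc a b) t =
          iteratedDerivWithin j (y q).fn (Icc a b) t +
          iteratedDerivWithin j (z q).fn (Icc a b) t := fun j q => ht j.castSucc q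
    simp only [diffExpr, Pi.add_apply, hr, hj, mul_add, Finset.sum_add_distrib]
    ring
  map_smul' c y := by
    refine PiLp.ext fun i => SobolevSpace.ext_fn ?_
    refine (SobolevSpace.fn_mk _ (memSobolev_diffExpr A (c • y) i)).trans ?_
    refine EventuallyEq.trans ?_ (SobolevSpace.deriv_fn_smul c
      (SobolevSpace.mk _ (memSobolev_diffExpr A y i)) 0 (Nat.zero_le _)).symm
    simp only [iteratedDerivWithin_zero]
    refine EventuallyEq.trans ?_
      ((SobolevSpace.fn_mk _ (memSobolev_diffExpr A y i)).const_smul c).symm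
    have h1 : ∀ j : Fin (r + 1), ∀ q : Fin m, ∀ᵐ t ∂volume.restrict (Icc a b),
        iteratedDerivWithin j ((c • y) q).fn (Icc a b) t =
          c * iteratedDerivWithin j (y q).fn (Icc a b) t := fun j q =>
      SobolevSpace.deriv_fn_smul c (y q) j (by have := j.2; omega)
    filter_upwards [ae_all_iff.2 fun j => ae_all_iff.2 (h1 j)] with t ht
    have hr := ht (Fin.last r) i
    simp only [Fin.val_last] at hr
    have hj : ∀ (j : Fin r) (q : Fin m), iteratedDerivWithin j ((c • y) q).fn (Icc a b) t =
          c * iteratedDerivWithin j (y q).fn (Icc a b) t := fun j q => ht j.castSucc q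
    simp only [diffExpr, Pi.smul_apply, smul_eq_mul, hr, hj, mul_add, Finset.mul_sum]
    congr 1
    refine Finset.sum_congr rfl fun j _ => Finset.sum_congr rfl fun q _ => ?_
    ring

/-- The operator `(L, B) : (W_p^{n+r})^m → (W_p^n)^m × ℂ^l` of the boundary-value problem
`L y = f`, `B y = c`. -/
noncomputable def bvpOp (A : Fin r → Matrix (Fin m) (Fin m) (SobolevSpace a b p n))
    (B : SobolevVec a b p (n + r) m →L[ℂ] (Fin l → ℂ)) :
    SobolevVec a b p (n + r) m →ₗ[ℂ] SobolevVec a b p n m × (Fin l → ℂ) :=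
  (diffOp A).prod B.toLinearMap

end Operator

/-- Strong (pointwise) convergence of a sequence of linear operators. -/
def StronglyConverges {E₁ E₂ : Type*} [NormedAddCommGroup E₁] [NormedSpace ℂ E₁]
    [NormedAddCommGroup E₂] [NormedSpace ℂ E₂] (T : ℕ → E₁ →ₗ[ℂ] E₂) (T₀ : E₁ →ₗ[ℂ] E₂) : Prop :=
  ∀ x : E₁, Tendsto (fun k => T k x) atTop (𝓝 (T₀ x))

/-- The dimension of the kernel of a linear operator. -/
noncomputable def dimKer {E₁ E₂ : Type*} [AddCommGroup E₁] [Module ℂ E₁]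
    [AddCommGroup E₂] [Module ℂ E₂] (T : E₁ →ₗ[ℂ] E₂) : Cardinal :=
  Module.rank ℂ (LinearMap.ker T)

/-- The dimension of the co-kernel `E₂ / T(E₁)` of a linear operator. -/
noncomputable def dimCoker {E₁ E₂ : Type*} [AddCommGroup E₁] [Module ℂ E₁]
    [AddCommGroup E₂] [Module ℂ E₂] (T : E₁ →ₗ[ℂ] E₂) : Cardinal :=
  Module.rank ℂ (E₂ ⧸ LinearMap.range T)

end SobolevBVP

/-!
# Semicontinuity of kernel and co-kernel for linear boundary-value problems

The operator `L` is surjective with a finite-dimensional kernel `N`, because the Cauchy problem for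
`L` is uniquely solvable. Hence, with a projection `C` onto `N`, the operator `(L, C)` is an
isomorphism, and the kernel and co-kernel of `(L, B)` are those of the *characteristic map*
`v ↦ B ((L, C)⁻¹ (0, v))` from `N` to `ℂ^l` (`rank_ker_prod_and_coker_prod`). If `L(k) → L` in
operator norm, then `(L(k), C)` is invertible for large `k` and the inverses converge; if moreover
`B(k) → B` strongly, the Banach–Steinhaus theorem shows that the characteristic maps converge. The
rank of a linear map between finite-dimensional spaces is lower semicontinuous, so the kernel and
co-kernel dimensions are upper semicontinuous (`eventually_rank_le`).

Three facts about the Sobolev spaces feed this argument.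

* The spaces are complete: a tuple in `L_p` consists of successive derivatives iff each entry is the
  primitive of the next one up to a constant, and this is a closed condition
  (`mem_sobolevSubmodule_iff`).
* Strong convergence `L(k) → L` implies convergence in norm. Testing on `(t - a)^j / j!` recovers
  the coefficients one after another, so they converge in `W_p^n` (`tendsto_coeff`); and `L` depends
  continuously on its coefficients because multiplication `W_p^n × W_p^{n+1} → W_p^n` is bounded
  (`SobolevSpace.mulL`, `tendsto_diffOpL`). All these bounds come from the closed graph theorem.
* `L` is surjective and an element of its kernel is determined by its initial values
  (`surjective_diffOp`, `eq_zero_of_diffOp_eq_zero`). This is Carathéodory's theorem for first-order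
  linear systems with integrable coefficients (`existsUnique_linear_system`), applied to the
  companion system.
-/

namespace SobolevBVP

/-! ### Semicontinuity in Banach spaces -/

section Abstract

universe u

/-- The rank is lower semicontinuous: linear independence of the images is an open condition. -/
theorem finrank_range_le_eventually {F G : Type*} [AddCommGroup F] [Module ℂ F]
    [FiniteDimensional ℂ F] [NormedAddCommGroup G] [NormedSpace ℂ G] [FiniteDimensional ℂ G]
    {M : F →ₗ[ℂ] G} {N : ℕ → F →ₗ[ℂ] G} (h : ∀ x, Tendsto (fun k => N k x) atTop (𝓝 (M x))) :
    ∀ᶠ k in atTop, Module.finrank ℂ (LinearMap.range M) ≤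
      Module.finrank ℂ (LinearMap.range (N k)) := by
  let e := Module.finBasis ℂ (LinearMap.range M)
  choose x hx using fun i => (e i).2
  have hli : LinearIndependent ℂ fun i => M (x i) := by
    simp only [hx]
    exact e.linearIndependent.map' (LinearMap.range M).subtype (Submodule.ker_subtype _)
  have ht : Tendsto (fun k i => N k (x i)) atTop (𝓝 fun i => M (x i)) :=
    tendsto_pi_nhds.2 fun i => h (x i)
  filter_upwards [ht.eventually hli.eventually] with k hk
  have h1 : LinearIndependent ℂ fun i => (⟨N k (x i), x i, rfl⟩ : LinearMap.range (N k)) :=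
    LinearIndependent.of_comp (LinearMap.range (N k)).subtype hk
  simpa using h1.fintype_card_le_finrank

/-- The part of the argument that is pure linear algebra: if `(L, C)` is an isomorphism onto
`E₂ × F`, then kernel and co-kernel of `(L, B)` are those of the characteristic map
`v ↦ B ((L, C)⁻¹ (0, v))` between finite-dimensional spaces. -/
theorem rank_ker_prod_and_coker_prod {E₁ E₂ F G : Type u} [AddCommGroup E₁] [Module ℂ E₁]
    [AddCommGroup E₂] [Module ℂ E₂] [AddCommGroup F] [Module ℂ F] [AddCommGroup G] [Module ℂ G]
    (Φ : E₁ ≃ₗ[ℂ] E₂ × F) (B : E₁ →ₗ[ℂ] G) (M : F →ₗ[ℂ] G) (hM : ∀ v, M v = B (Φ.symm (0, v))) :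
    Module.rank ℂ (LinearMap.ker ((LinearMap.fst ℂ E₂ F ∘ₗ Φ.toLinearMap).prod B)) =
      Module.rank ℂ (LinearMap.ker M) ∧
    Module.rank ℂ ((E₂ × G) ⧸ LinearMap.range ((LinearMap.fst ℂ E₂ F ∘ₗ Φ.toLinearMap).prod B)) =
      Module.rank ℂ (G ⧸ LinearMap.range M) := by
  set T := (LinearMap.fst ℂ E₂ F ∘ₗ Φ.toLinearMap).prod B with hT
  constructor
  · have h1 : LinearMap.ker T =
        (LinearMap.ker M).map (Φ.symm.toLinearMap ∘ₗ LinearMap.inr ℂ E₂ F) := by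
      ext x
      simp only [hT, LinearMap.mem_ker, LinearMap.prod_apply, Function.prod_apply,
        Submodule.mem_map, LinearMap.comp_apply, Prod.mk_eq_zero]
      constructor
      · rintro ⟨h1, h2⟩
        have h3 : ((0 : E₂), (Φ x).2) = Φ x := Prod.ext h1.symm rfl
        refine ⟨(Φ x).2, ?_, ?_⟩
        · rw [hM, h3]; simpa using h2
        · simp [h3]
      · rintro ⟨v, hv, rfl⟩
        rw [hM] at hv
        simpa using hv
    rw [h1]
    refine (LinearEquiv.rank_eq (Submodule.equivMapOfInjective _ ?_ (LinearMap.ker M))).symm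
    exact Φ.symm.injective.comp LinearMap.inr_injective
  · let q : G →ₗ[ℂ] (E₂ × G) ⧸ LinearMap.range T :=
      (LinearMap.range T).mkQ ∘ₗ LinearMap.inr ℂ E₂ G
    have hq : Function.Surjective q := by
      intro z
      obtain ⟨⟨e, g⟩, rfl⟩ := Submodule.mkQ_surjective _ z
      refine ⟨g - B (Φ.symm (e, 0)), ?_⟩
      simp only [q, LinearMap.comp_apply, Submodule.mkQ_apply]
      rw [Submodule.Quotient.eq]
      refine ⟨-Φ.symm (e, 0), ?_⟩
      simp [hT]
    have hker : LinearMap.ker q = LinearMap.range M := by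
      ext g
      simp only [q, LinearMap.mem_ker, LinearMap.comp_apply, Submodule.mkQ_apply,
        Submodule.Quotient.mk_eq_zero, LinearMap.mem_range]
      constructor
      · rintro ⟨x, hx⟩
        simp only [hT, LinearMap.prod_apply, Function.prod_apply, LinearMap.inr_apply,
          Prod.mk.injEq, LinearMap.comp_apply] at hx
        refine ⟨(Φ x).2, ?_⟩
        have h3 : ((0 : E₂), (Φ x).2) = Φ x := Prod.ext hx.1.symm rfl
        rw [hM, h3]; simpa using hx.2
      · rintro ⟨v, rfl⟩
        exact ⟨Φ.symm (0, v), by simp [hT, hM]⟩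
    rw [← hker]
    exact (LinearEquiv.rank_eq (LinearMap.quotKerEquivOfSurjective q hq)).symm

/-- Semicontinuity of the kernel and co-kernel dimensions of `(L, B)` under convergence of `L` in
norm and pointwise convergence of the finite-rank part `B`. -/
theorem eventually_rank_le {E₁ E₂ G : Type u}
    [NormedAddCommGroup E₁] [NormedSpace ℂ E₁] [CompleteSpace E₁]
    [NormedAddCommGroup E₂] [NormedSpace ℂ E₂] [CompleteSpace E₂]
    [NormedAddCommGroup G] [NormedSpace ℂ G] [FiniteDimensional ℂ G]
    (L : E₁ →L[ℂ] E₂) (B : E₁ →L[ℂ] G) (Ls : ℕ → E₁ →L[ℂ] E₂) (Bs : ℕ → E₁ →L[ℂ] G)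
    (hsurj : Function.Surjective L) (hfin : FiniteDimensional ℂ (LinearMap.ker L.toLinearMap))
    (hL : Tendsto Ls atTop (𝓝 L)) (hB : ∀ x, Tendsto (fun k => Bs k x) atTop (𝓝 (B x))) :
    ∀ᶠ k in atTop,
      Module.rank ℂ (LinearMap.ker ((Ls k).toLinearMap.prod (Bs k).toLinearMap)) ≤
        Module.rank ℂ (LinearMap.ker (L.toLinearMap.prod B.toLinearMap)) ∧
      Module.rank ℂ ((E₂ × G) ⧸ LinearMap.range ((Ls k).toLinearMap.prod (Bs k).toLinearMap)) ≤
        Module.rank ℂ ((E₂ × G) ⧸ LinearMap.range (L.toLinearMap.prod B.toLinearMap)) := by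
  obtain ⟨C, hC⟩ := Submodule.ClosedComplemented.of_finiteDimensional (LinearMap.ker L.toLinearMap)
  -- `C` is the identity on `ker L`, so `(L, C)` is bijective; its inverse is bounded by the open
  -- mapping theorem.
  have hinj : LinearMap.ker (L.prod C).toLinearMap = ⊥ := by
    rw [LinearMap.ker_eq_bot']
    intro x hx
    have hx1 : L x = 0 := congrArg Prod.fst hx
    have hx2 : C x = 0 := congrArg Prod.snd hx
    have := hC ⟨x, hx1⟩
    rw [hx2] at this
    exact (congrArg Subtype.val this).symm
  have hsur : LinearMap.range (L.prod C).toLinearMap = ⊤ := by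
    rw [LinearMap.range_eq_top]
    rintro ⟨e, v⟩
    obtain ⟨x, rfl⟩ := hsurj e
    -- `x - C x + v` has the same image as `x` under `L`, and `C` maps it to `v`.
    refine ⟨x - C x + v, ?_⟩
    have h1 : ∀ w : LinearMap.ker L.toLinearMap, L w = 0 := fun w => w.2
    simp [h1, hC]
  let Φ := ContinuousLinearEquiv.ofBijective (L.prod C) hinj hsur
  have hΦ : (Φ : E₁ →L[ℂ] E₂ × LinearMap.ker L.toLinearMap) = L.prod C := rfl
  have hΦs : Tendsto (fun k => (Ls k).prod C) atTop
      (𝓝 (Φ : E₁ →L[ℂ] E₂ × LinearMap.ker L.toLinearMap)) := by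
    rw [hΦ]
    have h1 : ∀ S : E₁ →L[ℂ] E₂, S.prod C = (ContinuousLinearMap.inl ℂ E₂ _) ∘L S +
        (ContinuousLinearMap.inr ℂ E₂ _) ∘L C := fun S => by ext x <;> simp
    simp only [h1]
    exact ((continuous_const.clm_comp continuous_id).tendsto' _ _ rfl |>.comp hL).add_const _
  have hinv := ((contDiffAt_map_inverse (n := 0) Φ).continuousAt.tendsto.comp hΦs)
  rw [ContinuousLinearMap.inverse_equiv] at hinv
  -- The `Bs k` converge only pointwise, so uniform boundedness is needed to pass to the limit in
  -- `Bs k` applied to the convergent vectors `((Ls k, C)⁻¹ (0, v))`.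
  obtain ⟨K, hK⟩ : ∃ K, ∀ k, ‖Bs k‖ ≤ K := by
    refine banach_steinhaus fun x => ?_
    obtain ⟨K, hK⟩ := (hB x).norm.bddAbove_range
    exact ⟨K, fun k => hK ⟨k, rfl⟩⟩
  let M : LinearMap.ker L.toLinearMap →ₗ[ℂ] G :=
    B.toLinearMap ∘ₗ Φ.symm.toLinearMap ∘ₗ LinearMap.inr ℂ E₂ _
  let N : ℕ → LinearMap.ker L.toLinearMap →ₗ[ℂ] G := fun k =>
    (Bs k).toLinearMap ∘ₗ (ContinuousLinearMap.inverse ((Ls k).prod C)).toLinearMap ∘ₗ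
      LinearMap.inr ℂ E₂ _
  have hNM : ∀ v, Tendsto (fun k => N k v) atTop (𝓝 (M v)) := by
    intro v
    have h1 : Tendsto (fun k => ContinuousLinearMap.inverse ((Ls k).prod C) (0, v)) atTop
        (𝓝 (Φ.symm (0, v))) :=
      ((ContinuousLinearMap.apply ℂ E₁ ((0 : E₂), v)).continuous.tendsto _).comp hinv
    have h2 : Tendsto (fun k => Bs k (ContinuousLinearMap.inverse ((Ls k).prod C) (0, v)
        - Φ.symm (0, v))) atTop (𝓝 0) := by
      have h3 := (tendsto_iff_norm_sub_tendsto_zero.1 h1).const_mul K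
      rw [mul_zero] at h3
      exact squeeze_zero_norm (fun k => (Bs k).le_of_opNorm_le (hK k) _) h3
    have h4 := h2.add (hB (Φ.symm (0, v)))
    simp only [map_sub, sub_add_cancel, zero_add] at h4
    exact h4
  have hNk : ∀ᶠ k in atTop, ∃ Ψ : E₁ ≃L[ℂ] E₂ × LinearMap.ker L.toLinearMap,
      (Ψ : E₁ →L[ℂ] E₂ × LinearMap.ker L.toLinearMap) = (Ls k).prod C :=
    hΦs.eventually (ContinuousLinearEquiv.nhds Φ)
  have hlim := rank_ker_prod_and_coker_prod Φ.toLinearEquiv B.toLinearMap M fun v => rfl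
  filter_upwards [hNk, finrank_range_le_eventually hNM] with k hk hrank
  obtain ⟨Ψ, hΨ⟩ := hk
  have hseq := rank_ker_prod_and_coker_prod Ψ.toLinearEquiv (Bs k).toLinearMap (N k) fun v => by
    simp only [N, ← hΨ, ContinuousLinearMap.inverse_equiv]
    rfl
  have e1 : LinearMap.fst ℂ E₂ _ ∘ₗ Φ.toLinearEquiv.toLinearMap = L.toLinearMap := rfl
  have e2 : LinearMap.fst ℂ E₂ _ ∘ₗ Ψ.toLinearEquiv.toLinearMap = (Ls k).toLinearMap := by
    ext x
    exact congrArg Prod.fst (congrArg (fun S => S x) hΨ)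
  rw [e1] at hlim
  rw [e2] at hseq
  rw [hlim.1, hlim.2, hseq.1, hseq.2]
  simp only [← Module.finrank_eq_rank, Nat.cast_le]
  have d1 := LinearMap.finrank_range_add_finrank_ker M
  have d2 := LinearMap.finrank_range_add_finrank_ker (N k)
  have d3 := Submodule.finrank_quotient_add_finrank (LinearMap.range M)
  have d4 := Submodule.finrank_quotient_add_finrank (LinearMap.range (N k))
  omega

end Abstract

/-! ### Primitives of integrable functions -/

section Primitives

variable {a b : ℝ} {p : ℝ≥0∞} {s : ℕ} {g y : ℝ → ℂ}

/-- Absolute continuity passes to a function whose increments are dominated by those of an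
absolutely continuous one. -/
theorem ac_of_dist_le {X Y : Type*} [PseudoMetricSpace X] [PseudoMetricSpace Y] {f : ℝ → X}
    {g : ℝ → Y} {K : ℝ} (hK : 0 < K)
    (h : ∀ x ∈ uIcc a b, ∀ y ∈ uIcc a b, dist (f x) (f y) ≤ K * dist (g x) (g y))
    (hg : AbsolutelyContinuousOnInterval g a b) : AbsolutelyContinuousOnInterval f a b := by
  rw [absolutelyContinuousOnInterval_iff] at hg ⊢
  intro ε hε
  obtain ⟨δ, hδ, H⟩ := hg (ε / K) (by positivity)
  refine ⟨δ, hδ, fun E hE hlt => ?_⟩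
  have h1 := H E hE hlt
  rw [lt_div_iff₀' hK, Finset.mul_sum] at h1
  refine (Finset.sum_le_sum fun i hi => ?_).trans_lt h1
  exact h _ (hE.1 i hi).1 _ (hE.1 i hi).2

theorem MemSobolev.of_le {s' : ℕ} (hab : a < b) (h : s ≤ s') (hy : MemSobolev a b p s' y) :
    MemSobolev a b p s y :=
  MemSobolev.mono hab (j := s' - s) (by rwa [Nat.add_sub_of_le h])

theorem intervalIntegrable_of_memLp (hab : a < b) (hp : 1 ≤ p)
    (hg : MemLp g p (volume.restrict (Icc a b))) : IntervalIntegrable g volume a b :=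
  (intervalIntegrable_iff_integrableOn_Icc_of_le hab.le).2 (hg.integrable hp)

theorem IntervalIntegrable.mono_Icc {E : Type*} [NormedAddCommGroup E] {g : ℝ → E} (hab : a < b)
    (hg : IntervalIntegrable g volume a b) {x t : ℝ} (hx : x ∈ Icc a b) (ht : t ∈ Icc a b) :
    IntervalIntegrable g volume x t := by
  refine hg.mono_set ?_
  rw [uIcc_of_le hab.le]
  exact ordConnected_Icc.uIcc_subset hx ht

theorem ac_primitive {g : ℝ → ℂ} (hab : a < b) (hg : IntervalIntegrable g volume a b) :
    AbsolutelyContinuousOnInterval (fun t => ∫ x in a..t, g x) a b := by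
  refine ac_of_dist_le one_pos (fun x hx y hy => ?_)
    (hg.norm.absolutelyContinuousOnInterval_intervalIntegral (c := a) left_mem_uIcc)
  rw [uIcc_of_le hab.le] at hx hy
  have ha : a ∈ Icc a b := left_mem_Icc.2 hab.le
  have i1 := fun t (ht : t ∈ Icc a b) => IntervalIntegrable.mono_Icc hab hg ha ht
  rw [one_mul, dist_eq_norm, dist_eq_norm,
    intervalIntegral.integral_interval_sub_left (i1 x hx) (i1 y hy),
    intervalIntegral.integral_interval_sub_left (i1 x hx).norm (i1 y hy).norm, Real.norm_eq_abs]
  exact intervalIntegral.norm_integral_le_abs_integral_norm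

theorem ae_hasDerivAt_primitive {E : Type*} [NormedAddCommGroup E] [NormedSpace ℝ E]
    [CompleteSpace E] {g : ℝ → E} (hab : a < b) (hg : IntervalIntegrable g volume a b) :
    ∀ᵐ x ∂volume.restrict (Icc a b), HasDerivAt (fun t => ∫ z in a..t, g z) (g x) x := by
  rw [ae_restrict_iff' measurableSet_Icc]
  filter_upwards [hg.ae_hasDerivAt_integral] with x hx hxI
  rw [uIcc_of_le hab.le] at hx
  exact hx hxI a (left_mem_Icc.2 hab.le)

theorem derivWithin_ae_eq_of_eq_primitive {c : ℂ} (hab : a < b)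
    (hg : IntervalIntegrable g volume a b) (h : ∀ t ∈ Icc a b, y t = c + ∫ x in a..t, g x) :
    derivWithin y (Icc a b) =ᵐ[volume.restrict (Icc a b)] g := by
  filter_upwards [ae_hasDerivAt_primitive hab hg, ae_restrict_mem measurableSet_Icc] with x hx hxI
  exact ((hx.hasDerivWithinAt.const_add c).congr h (h x hxI)).derivWithin
    (uniqueDiffOn_Icc hab x hxI)

theorem hasDerivWithinAt_of_eq_primitive {c : ℂ} (hab : a < b) (hg : ContinuousOn g (Icc a b))
    (h : ∀ t ∈ Icc a b, y t = c + ∫ x in a..t, g x) {x : ℝ} (hx : x ∈ Icc a b) :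
    HasDerivWithinAt y (g x) (Icc a b) x := by
  have : Fact (x ∈ Icc a b) := ⟨hx⟩
  have hi : IntervalIntegrable g volume a b := by
    rw [← uIcc_of_le hab.le] at hg
    exact hg.intervalIntegrable
  have h1 := intervalIntegral.integral_hasDerivWithinAt_right (s := Icc a b) (t := Icc a b)
    (IntervalIntegrable.mono_Icc hab hi (left_mem_Icc.2 hab.le) hx)
    (hg.stronglyMeasurableAtFilter_nhdsWithin measurableSet_Icc x) (hg x hx)
  exact (h1.const_add c).congr h (h x hx)

/-- Integration raises the Sobolev order by one. -/
theorem MemSobolev.of_eq_primitive {c : ℂ} (hab : a < b) (hp : 1 ≤ p) (hg : MemSobolev a b p s g)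
    (h : ∀ t ∈ Icc a b, y t = c + ∫ x in a..t, g x) : MemSobolev a b p (s + 1) y := by
  cases s with
  | zero =>
    have hi := intervalIntegrable_of_memLp hab hp hg
    have hac : AbsolutelyContinuousOnInterval y a b := by
      refine ac_of_dist_le one_pos (fun x hx y hy => ?_) (ac_primitive hab hi)
      rw [uIcc_of_le hab.le] at hx hy
      rw [h x hx, h y hy, dist_add_left, one_mul]
    refine ⟨?_, by simpa using hac, ?_⟩
    · simpa [contDiffOn_zero] using ac_continuousOn hab hac
    · change MemLp (_root_.iteratedDerivWithin 1 y (Icc a b)) p _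
      rw [iteratedDerivWithin_one]
      exact MemLp.ae_eq (derivWithin_ae_eq_of_eq_primitive hab hi h).symm hg
  | succ s =>
    have hd := fun x (hx : x ∈ Icc a b) =>
      hasDerivWithinAt_of_eq_primitive hab hg.continuousOn h hx
    rw [MemSobolev.succ_succ_iff hab]
    refine ⟨fun x hx => (hd x hx).differentiableWithinAt, hg.congr hab fun x hx => ?_⟩
    exact ((hd x hx).derivWithin (uniqueDiffOn_Icc hab x hx)).symm

/-- The fundamental theorem of calculus for functions of Sobolev class. -/
theorem MemSobolev.eq_add_integral_derivWithin (hab : a < b) (hp : 1 ≤ p)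
    (hy : MemSobolev a b p (s + 1) y) :
    ∀ t ∈ Icc a b, y t = y a + ∫ x in a..t, derivWithin y (Icc a b) x := by
  have hy1 : MemSobolev a b p 1 y := hy.of_le hab (by omega)
  have hac : AbsolutelyContinuousOnInterval y a b := by simpa using hy1.2.1
  have hi : IntervalIntegrable (derivWithin y (Icc a b)) volume a b :=
    intervalIntegrable_of_memLp hab hp (by simpa [iteratedDerivWithin_one] using hy1.2.2)
  have hF := hac.sub (ac_primitive hab hi)
  -- `y` minus the primitive of its derivative is absolutely continuous with zero derivative almost
  -- everywhere; the endpoints are excluded to turn one-sided derivatives into derivatives.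
  obtain ⟨C, hC⟩ := hF.const_of_ae_hasDerivAt_zero (by
    have h1 := ae_hasDerivAt_primitive hab hi
    have h2 := ac_ae_diff hab hac
    rw [ae_restrict_iff' measurableSet_Icc] at h1 h2
    have h3 : ∀ᵐ x : ℝ, x ≠ a ∧ x ≠ b := by
      filter_upwards [compl_mem_ae_iff.2 (measure_singleton a),
        compl_mem_ae_iff.2 (measure_singleton b)] with x hxa hxb using ⟨hxa, hxb⟩
    filter_upwards [h1, h2, h3] with x hx1 hx2 hx3 hx
    rw [uIcc_of_le hab.le] at hx
    have hnhds : Icc a b ∈ 𝓝 x :=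
      Icc_mem_nhds (lt_of_le_of_ne hx.1 hx3.1.symm) (lt_of_le_of_ne hx.2 hx3.2)
    have := (hx2 hx).hasDerivWithinAt.hasDerivAt hnhds
    simpa using! this.sub (hx1 hx))
  intro t ht
  have e1 := hC a left_mem_uIcc
  have e2 := hC t (by rwa [uIcc_of_le hab.le])
  simp only [Pi.sub_apply, intervalIntegral.integral_same, sub_zero] at e1 e2
  rw [e1, ← e2]
  ring

theorem integral_congr_restrict {f g : ℝ → ℂ} (h : f =ᵐ[volume.restrict (Icc a b)] g) {t : ℝ}
    (ht : t ∈ Icc a b) : ∫ x in a..t, f x = ∫ x in a..t, g x := by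
  refine intervalIntegral.integral_congr_ae ?_
  rw [EventuallyEq, ae_restrict_iff' measurableSet_Icc] at h
  filter_upwards [h] with x hx hxI
  rw [uIoc_of_le ht.1] at hxI
  exact hx ⟨hxI.1.le, hxI.2.trans ht.2⟩

theorem MemSobolev.of_contDiff {y : ℝ → ℂ} (hab : a < b) (s : ℕ) (hy : ∀ k : ℕ, ContDiff ℝ k y) :
    MemSobolev a b p s y := by
  have h1 : ∀ k, ContinuousOn (_root_.iteratedDerivWithin k y (Icc a b)) (Icc a b) := fun k =>
    (hy k).contDiffOn.continuousOn_iteratedDerivWithin le_rfl (uniqueDiffOn_Icc hab)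
  cases s with
  | zero => exact memLp_of_continuousOn (hy 0).continuous.continuousOn
  | succ s =>
    refine ⟨(hy s).contDiffOn, ac_of_contDiffOn hab ?_, memLp_of_continuousOn (h1 (s + 1))⟩
    have h2 := (hy (s + 1)).contDiffOn (s := Icc a b)
    push_cast at h2
    exact ((contDiffOn_nat_succ_iff_contDiffOn_one_iteratedDerivWithin
      (uniqueDiffOn_Icc hab)).1 h2).2

end Primitives

/-! ### Completeness of the Sobolev spaces -/

section Complete

variable {a b : ℝ} [hab : Fact (a < b)] {p : ℝ≥0∞} [hp : Fact (1 ≤ p)] {s : ℕ}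

/-- Primitives are bounded by the `L_p` norm; the constant is that of the inclusion `L_p ⊆ L_1`. -/
theorem norm_integral_le_mul_norm_Lp (f : Lp ℂ p (volume.restrict (Icc a b))) {t : ℝ}
    (ht : t ∈ Icc a b) : ‖∫ x in a..t, f x‖ ≤
      (volume.restrict (Icc a b) univ ^ (1 / (1 : ℝ≥0∞).toReal - 1 / p.toReal)).toReal * ‖f‖ := by
  have hi := intervalIntegrable_of_memLp hab.out hp.out (Lp.memLp f)
  have hE : 0 ≤ 1 / (1 : ℝ≥0∞).toReal - 1 / p.toReal := by
    simp only [ENNReal.toReal_one, div_one, sub_nonneg, one_div]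
    rcases eq_or_ne p ∞ with rfl | hpt
    · simp
    · exact inv_le_one_of_one_le₀ (by simpa using ENNReal.toReal_mono hpt hp.out)
  calc ‖∫ x in a..t, f x‖ ≤ ∫ x in a..t, ‖f x‖ :=
        intervalIntegral.norm_integral_le_integral_norm ht.1
    _ ≤ ∫ x in a..b, ‖f x‖ := intervalIntegral.integral_mono_interval le_rfl ht.1 ht.2
        (Eventually.of_forall fun _ => norm_nonneg _) hi.norm
    _ = ∫ x in Icc a b, ‖f x‖ := by
        rw [intervalIntegral.integral_of_le hab.out.le, integral_Icc_eq_integral_Ioc]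
    _ = (eLpNorm f 1 (volume.restrict (Icc a b))).toReal := by
        rw [eLpNorm_one_eq_lintegral_enorm, integral_norm_eq_lintegral_enorm
          (Lp.aestronglyMeasurable f)]
    _ ≤ (eLpNorm f p (volume.restrict (Icc a b)) *
          volume.restrict (Icc a b) univ ^ (1 / (1 : ℝ≥0∞).toReal - 1 / p.toReal)).toReal := by
        refine ENNReal.toReal_mono ?_
          (eLpNorm_le_eLpNorm_mul_rpow_measure_univ hp.out (Lp.aestronglyMeasurable f))
        exact ENNReal.mul_ne_top (Lp.eLpNorm_ne_top f)
          (ENNReal.rpow_ne_top_of_nonneg hE (measure_ne_top _ _))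
    _ = _ := by rw [ENNReal.toReal_mul, mul_comm, Lp.norm_def]

theorem continuousOn_primitive_Lp (f : Lp ℂ p (volume.restrict (Icc a b))) :
    ContinuousOn (fun t => ∫ x in a..t, f x) (Icc a b) :=
  ac_continuousOn hab.out
    (ac_primitive hab.out (intervalIntegrable_of_memLp hab.out hp.out (Lp.memLp f)))

/-- The Volterra operator `f ↦ ∫_a^t f` on `L_p([a, b])`. -/
noncomputable def volterraLp (a b : ℝ) [hab : Fact (a < b)] (p : ℝ≥0∞) [hp : Fact (1 ≤ p)] :
    Lp ℂ p (volume.restrict (Icc a b)) →L[ℂ] Lp ℂ p (volume.restrict (Icc a b)) :=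
  LinearMap.mkContinuous
    { toFun := fun f => (memLp_of_continuousOn (p := p) (continuousOn_primitive_Lp f)).toLp _
      map_add' := fun f g => by
        refine Lp.ext ?_
        filter_upwards [MemLp.coeFn_toLp (memLp_of_continuousOn (p := p)
            (continuousOn_primitive_Lp (f + g))),
          Lp.coeFn_add ((memLp_of_continuousOn (p := p) (continuousOn_primitive_Lp f)).toLp _)
            ((memLp_of_continuousOn (p := p) (continuousOn_primitive_Lp g)).toLp _),
          MemLp.coeFn_toLp (memLp_of_continuousOn (p := p) (continuousOn_primitive_Lp f)),
          MemLp.coeFn_toLp (memLp_of_continuousOn (p := p) (continuousOn_primitive_Lp g)),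
          ae_restrict_mem measurableSet_Icc] with t h1 h2 h3 h4 ht
        have hi := fun f : Lp ℂ p (volume.restrict (Icc a b)) =>
          IntervalIntegrable.mono_Icc hab.out
            (intervalIntegrable_of_memLp hab.out hp.out (Lp.memLp f))
            (left_mem_Icc.2 hab.out.le) ht
        rw [h1, h2, Pi.add_apply, h3, h4, integral_congr_restrict (Lp.coeFn_add f g) ht]
        exact intervalIntegral.integral_add (hi f) (hi g)
      map_smul' := fun c f => by
        refine Lp.ext ?_
        filter_upwards [MemLp.coeFn_toLp (memLp_of_continuousOn (p := p)
            (continuousOn_primitive_Lp (c • f))),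
          Lp.coeFn_smul c ((memLp_of_continuousOn (p := p) (continuousOn_primitive_Lp f)).toLp _),
          MemLp.coeFn_toLp (memLp_of_continuousOn (p := p) (continuousOn_primitive_Lp f)),
          ae_restrict_mem measurableSet_Icc] with t h1 h2 h3 ht
        rw [h1, RingHom.id_apply, h2, Pi.smul_apply, h3,
          integral_congr_restrict (Lp.coeFn_smul c f) ht]
        exact intervalIntegral.integral_smul c f }
    ((measureUnivNNReal (volume.restrict (Icc a b)) : ℝ) ^ p.toReal⁻¹ *
      (volume.restrict (Icc a b) univ ^ (1 / (1 : ℝ≥0∞).toReal - 1 / p.toReal)).toReal)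
    fun f => by
      rw [mul_assoc]
      refine Lp.norm_le_of_ae_bound (by positivity) ?_
      filter_upwards [MemLp.coeFn_toLp (memLp_of_continuousOn (p := p)
        (continuousOn_primitive_Lp f)), ae_restrict_mem measurableSet_Icc] with t h1 ht
      refine le_of_eq_of_le (congrArg norm h1) ?_
      exact norm_integral_le_mul_norm_Lp f ht

theorem coeFn_volterraLp (f : Lp ℂ p (volume.restrict (Icc a b))) :
    volterraLp a b p f =ᵐ[volume.restrict (Icc a b)] fun t => ∫ x in a..t, f x :=
  MemLp.coeFn_toLp (memLp_of_continuousOn (p := p) (continuousOn_primitive_Lp f))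

/-- The constant function `1` in `L_p([a, b])`. -/
noncomputable def oneLp (a b : ℝ) (p : ℝ≥0∞) : Lp ℂ p (volume.restrict (Icc a b)) :=
  (memLp_of_continuousOn (p := p) (continuousOn_const (c := (1 : ℂ)))).toLp fun _ => 1

theorem sub_volterraLp_mem_span_iff {f g : Lp ℂ p (volume.restrict (Icc a b))} :
    f - volterraLp a b p g ∈ Submodule.span ℂ {oneLp a b p} ↔
      ∃ c : ℂ, f =ᵐ[volume.restrict (Icc a b)] fun t => c + ∫ x in a..t, g x := by
  have h1 : oneLp a b p =ᵐ[volume.restrict (Icc a b)] fun _ => (1 : ℂ) :=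
    MemLp.coeFn_toLp (memLp_of_continuousOn (p := p) (continuousOn_const (c := (1 : ℂ))))
  rw [Submodule.mem_span_singleton]
  refine exists_congr fun c => ?_
  rw [eq_sub_iff_add_eq, eq_comm]
  have h2 : ⇑(c • oneLp a b p + volterraLp a b p g) =ᵐ[volume.restrict (Icc a b)]
      fun t => c + ∫ x in a..t, g x := by
    filter_upwards [h1, coeFn_volterraLp g, Lp.coeFn_add (c • oneLp a b p) (volterraLp a b p g),
      Lp.coeFn_smul c (oneLp a b p)] with t h3 h4 h5 h6
    rw [h5, Pi.add_apply, h6, Pi.smul_apply, h3, h4, smul_eq_mul, mul_one]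
  constructor
  · rintro h
    rw [h]
    exact h2
  · exact fun h => Lp.ext (h.trans h2.symm)

theorem MemSobolev.ae_iteratedDerivWithin_of_primitive {y z : ℝ → ℂ} {c : ℂ}
    (hz : MemSobolev a b p s z) (h : ∀ t ∈ Icc a b, y t = c + ∫ x in a..t, z x) {j : ℕ}
    (hj : j ≤ s) : _root_.iteratedDerivWithin (j + 1) y (Icc a b) =ᵐ[volume.restrict (Icc a b)]
      _root_.iteratedDerivWithin j z (Icc a b) := by
  have hy := hz.of_eq_primitive hab.out hp.out h
  have hd := MemSobolev.iteratedDerivWithin hab.out (j := 1) hy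
  rw [iteratedDerivWithin_one] at hd
  rw [iteratedDerivWithin_succ']
  refine hd.ae_congr hab.out hz (derivWithin_ae_eq_of_eq_primitive hab.out ?_ h) hj
  exact intervalIntegrable_of_memLp hab.out hp.out
    (by simpa using hz.memLp_iteratedDerivWithin hab.out (Nat.zero_le s))

/-- A tuple `(F₀, …, F_s)` in `L_p` consists of the derivatives of a function of Sobolev class
exactly when each `F_j` is, up to a constant, the primitive of `F_{j+1}`. -/
theorem mem_sobolevSubmodule_iff
    (F : PiLp 1 (fun _ : Fin (s + 1) => Lp ℂ p (volume.restrict (Icc a b)))) :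
    F ∈ sobolevSubmodule a b p s ↔ ∀ j : Fin s,
      F j.castSucc - volterraLp a b p (F j.succ) ∈ Submodule.span ℂ {oneLp a b p} := by
  simp only [sub_volterraLp_mem_span_iff]
  constructor
  · rintro ⟨y, hy, hF⟩ j
    refine ⟨iteratedDerivWithin j y (Icc a b) a, ?_⟩
    have hj : MemSobolev a b p (s - 1 - j + 1) (iteratedDerivWithin j y (Icc a b)) := by
      refine MemSobolev.iteratedDerivWithin hab.out ?_
      rwa [show s - 1 - (j : ℕ) + 1 + j = s by omega]
    have h1 := hF j.castSucc
    have h2 := hF j.succ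
    rw [Fin.val_succ, iteratedDerivWithin_succ] at h2
    filter_upwards [h1, ae_restrict_mem measurableSet_Icc] with t ht htI
    rw [ht, integral_congr_restrict h2 htI]
    exact hj.eq_add_integral_derivWithin hab.out hp.out t htI
  · intro h
    suffices H : ∀ (s : ℕ) (F : Fin (s + 1) → Lp ℂ p (volume.restrict (Icc a b))),
        (∀ j : Fin s, ∃ c : ℂ, F j.castSucc =ᵐ[volume.restrict (Icc a b)]
          fun t => c + ∫ x in a..t, F j.succ x) →
        ∃ y, MemSobolev a b p s y ∧ ∀ j : Fin (s + 1),
          F j =ᵐ[volume.restrict (Icc a b)] iteratedDerivWithin j y (Icc a b) from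
      H s F h
    clear h F
    intro s
    induction s with
    | zero =>
      intro F _
      refine ⟨F 0, Lp.memLp _, fun j => ?_⟩
      obtain rfl : j = 0 := Fin.ext (by omega)
      simp
    | succ s ih =>
      intro F h
      obtain ⟨z, hz, hzF⟩ := ih (fun j => F j.succ) fun j => h j.succ
      obtain ⟨c, hc⟩ := h 0
      have hz0 : F 1 =ᵐ[volume.restrict (Icc a b)] z := by simpa using hzF 0
      refine ⟨fun t => c + ∫ x in a..t, z x,
        hz.of_eq_primitive hab.out hp.out fun _ _ => rfl, fun j => ?_⟩
      refine Fin.cases ?_ (fun j => ?_) j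
      · simp only [Fin.val_zero, iteratedDerivWithin_zero]
        filter_upwards [hc, ae_restrict_mem measurableSet_Icc] with t ht htI
        rw [← integral_congr_restrict hz0 htI]
        exact ht
      · exact (hzF j).trans
          (hz.ae_iteratedDerivWithin_of_primitive (fun _ _ => rfl) (by omega)).symm

/-- The conditions of `mem_sobolevSubmodule_iff` are closed: the Volterra operator is continuous
and the line of constants is finite-dimensional. -/
theorem isClosed_sobolevSubmodule :
    IsClosed (sobolevSubmodule a b p s :
      Set (PiLp 1 (fun _ : Fin (s + 1) => Lp ℂ p (volume.restrict (Icc a b))))) := by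
  have h : (sobolevSubmodule a b p s : Set (PiLp 1 (fun _ : Fin (s + 1) =>
      Lp ℂ p (volume.restrict (Icc a b))))) = ⋂ j : Fin s,
      {F | F j.castSucc - volterraLp a b p (F j.succ) ∈ Submodule.span ℂ {oneLp a b p}} := by
    ext F
    simp only [SetLike.mem_coe, mem_sobolevSubmodule_iff, mem_iInter, mem_ofPred_eq]
  rw [h]
  refine isClosed_iInter fun j => ?_
  have hc : IsClosed (Submodule.span ℂ {oneLp a b p} : Set (Lp ℂ p (volume.restrict (Icc a b)))) :=
    Submodule.closed_of_finiteDimensional _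
  exact hc.preimage (by fun_prop)

instance : CompleteSpace (SobolevSpace a b p s) :=
  (isClosed_sobolevSubmodule (a := a) (b := b) (p := p) (s := s)).completeSpace_coe

end Complete

/-! ### Continuity of differentiation and multiplication -/

section Continuity

variable {a b : ℝ} [hab : Fact (a < b)] {p : ℝ≥0∞} [hp : Fact (1 ≤ p)] {s s' : ℕ}

namespace SobolevSpace

theorem fn_add (F G : SobolevSpace a b p s) :
    (F + G).fn =ᵐ[volume.restrict (Icc a b)] F.fn + G.fn := by
  simpa using deriv_fn_add F G 0 (Nat.zero_le s)

theorem fn_smul (c : ℂ) (F : SobolevSpace a b p s) :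
    (c • F).fn =ᵐ[volume.restrict (Icc a b)] c • F.fn := by
  simpa using deriv_fn_smul c F 0 (Nat.zero_le s)

theorem fn_zero : (0 : SobolevSpace a b p s).fn =ᵐ[volume.restrict (Icc a b)] 0 := by
  have h := fn_smul (0 : ℂ) (0 : SobolevSpace a b p s)
  rwa [zero_smul, zero_smul] at h

theorem exists_seq_tendsto_ae {u : ℕ → SobolevSpace a b p s} {F : SobolevSpace a b p s}
    (h : Tendsto u atTop (𝓝 F)) {j : ℕ} (hj : j ≤ s) :
    ∃ ns : ℕ → ℕ, StrictMono ns ∧ ∀ᵐ t ∂volume.restrict (Icc a b),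
      Tendsto (fun i => iteratedDerivWithin j (u (ns i)).fn (Icc a b) t) atTop
        (𝓝 (iteratedDerivWithin j F.fn (Icc a b) t)) := by
  let q : Fin (s + 1) := ⟨j, Nat.lt_succ_of_le hj⟩
  have h1 : Tendsto (fun i => (u i).1 q) atTop (𝓝 (F.1 q)) := by
    have hc : Continuous fun G : sobolevSubmodule a b p s => G.1 q := by fun_prop
    exact (hc.tendsto F).comp h
  obtain ⟨ns, hns, hae⟩ := (tendstoInMeasure_of_tendsto_Lp h1).exists_seq_tendsto_ae
  refine ⟨ns, hns, ?_⟩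
  filter_upwards [hae, F.ae_eq_fn q, ae_all_iff.2 fun i => (u (ns i)).ae_eq_fn q] with t h2 h3 h4
  rw [h3] at h2
  exact h2.congr h4

/-- A form of the closed graph theorem: since convergence in `W_p^s` entails convergence almost
everywhere along a subsequence, a linear map into `W_p^s` is continuous as soon as it is compatible
with limits in this weak sense. -/
theorem continuous_of_seq_tendsto_ae {E : Type*} [NormedAddCommGroup E] [NormedSpace ℂ E]
    [CompleteSpace E] (T : E →ₗ[ℂ] SobolevSpace a b p s)
    (H : ∀ (u : ℕ → E) (x : E), Tendsto u atTop (𝓝 x) → ∃ ns : ℕ → ℕ, StrictMono ns ∧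
      ∀ᵐ t ∂volume.restrict (Icc a b),
        Tendsto (fun i => (T (u (ns i))).fn t) atTop (𝓝 ((T x).fn t))) : Continuous T := by
  refine T.continuous_of_seq_closed_graph fun u x z hu hz => ext_fn ?_
  obtain ⟨ns, hns, h1⟩ := H u x hu
  obtain ⟨ms, hms, h2⟩ :=
    exists_seq_tendsto_ae (hz.comp hns.tendsto_atTop) (Nat.zero_le s)
  simp only [iteratedDerivWithin_zero] at h2
  filter_upwards [h1, h2] with t h3 h4
  exact tendsto_nhds_unique h4 (h3.comp hms.tendsto_atTop)

theorem memSobolev_iteratedDerivWithin_fn (F : SobolevSpace a b p s) {j : ℕ} (h : s' + j ≤ s) :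
    MemSobolev a b p s' (iteratedDerivWithin j F.fn (Icc a b)) :=
  (F.memSobolev_fn.of_le hab.out h).iteratedDerivWithin hab.out

/-- Differentiation `y ↦ y^(j)` as a continuous operator `W_p^s → W_p^{s'}`, `s' + j ≤ s`. -/
noncomputable def derivL (j : ℕ) (h : s' + j ≤ s) :
    SobolevSpace a b p s →L[ℂ] SobolevSpace a b p s' :=
  have hmem := fun F : SobolevSpace a b p s => memSobolev_iteratedDerivWithin_fn F h
  let T : SobolevSpace a b p s →ₗ[ℂ] SobolevSpace a b p s' :=
    { toFun := fun F => mk _ (hmem F)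
      map_add' := fun F G => ext_fn <| (fn_mk _ (hmem (F + G))).trans <|
        (deriv_fn_add F G j (by omega)).trans <|
        ((fn_mk _ (hmem F)).add (fn_mk _ (hmem G))).symm.trans (fn_add _ _).symm
      map_smul' := fun c F => ext_fn <| (fn_mk _ (hmem (c • F))).trans <|
        (deriv_fn_smul c F j (by omega)).trans <|
        ((fn_mk _ (hmem F)).const_smul c).symm.trans (fn_smul _ _).symm }
  { toLinearMap := T
    cont := continuous_of_seq_tendsto_ae T fun u F hu => by
      obtain ⟨ns, hns, hae⟩ := exists_seq_tendsto_ae hu (j := j) (by omega)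
      refine ⟨ns, hns, ?_⟩
      filter_upwards [hae, fn_mk _ (hmem F), ae_all_iff.2 fun i => fn_mk _ (hmem (u (ns i)))]
        with t h1 h2 h3
      change Tendsto (fun i => (mk _ (hmem (u (ns i)))).fn t) atTop (𝓝 ((mk _ (hmem F)).fn t))
      rw [h2]
      exact h1.congr fun i => (h3 i).symm }

theorem fn_derivL (j : ℕ) (h : s' + j ≤ s) (F : SobolevSpace a b p s) :
    (derivL j h F).fn =ᵐ[volume.restrict (Icc a b)] iteratedDerivWithin j F.fn (Icc a b) :=
  fn_mk _ (memSobolev_iteratedDerivWithin_fn F h)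

theorem memSobolev_mul (f : SobolevSpace a b p s) (g : SobolevSpace a b p (s + 1)) :
    MemSobolev a b p s (f.fn * g.fn) :=
  f.memSobolev_fn.mul hab.out g.memSobolev_fn

/-- Pointwise multiplication `W_p^s × W_p^{s+1} → W_p^s` as a bilinear map. -/
noncomputable def mulBilin : SobolevSpace a b p s →ₗ[ℂ] SobolevSpace a b p (s + 1) →ₗ[ℂ]
    SobolevSpace a b p s :=
  LinearMap.mk₂ ℂ (fun f g => mk _ (memSobolev_mul f g))
    (fun f f' g => by
      refine ext_fn ((fn_mk _ _).trans (EventuallyEq.trans ?_ (fn_add _ _).symm))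
      filter_upwards [fn_add f f', fn_mk _ (memSobolev_mul f g), fn_mk _ (memSobolev_mul f' g)]
        with t h1 h2 h3
      simp only [Pi.mul_apply, Pi.add_apply, h1, h2, h3, add_mul])
    (fun c f g => by
      refine ext_fn ((fn_mk _ _).trans (EventuallyEq.trans ?_ (fn_smul _ _).symm))
      filter_upwards [fn_smul c f, fn_mk _ (memSobolev_mul f g)] with t h1 h2
      simp only [Pi.mul_apply, Pi.smul_apply, h1, h2, smul_mul_assoc])
    (fun f g g' => by
      refine ext_fn ((fn_mk _ _).trans (EventuallyEq.trans ?_ (fn_add _ _).symm))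
      filter_upwards [fn_add g g', fn_mk _ (memSobolev_mul f g), fn_mk _ (memSobolev_mul f g')]
        with t h1 h2 h3
      simp only [Pi.mul_apply, Pi.add_apply, h1, h2, h3, mul_add])
    (fun c f g => by
      refine ext_fn ((fn_mk _ _).trans (EventuallyEq.trans ?_ (fn_smul _ _).symm))
      filter_upwards [fn_smul c g, fn_mk _ (memSobolev_mul f g)] with t h1 h2
      simp only [Pi.mul_apply, Pi.smul_apply, h1, h2, mul_smul_comm])

theorem fn_mulBilin (f : SobolevSpace a b p s) (g : SobolevSpace a b p (s + 1)) :
    (mulBilin f g).fn =ᵐ[volume.restrict (Icc a b)] f.fn * g.fn :=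
  fn_mk _ (memSobolev_mul f g)

theorem continuous_mulBilin_right (f : SobolevSpace a b p s) : Continuous (mulBilin f) := by
  refine continuous_of_seq_tendsto_ae _ fun u g hu => ?_
  obtain ⟨ns, hns, hae⟩ := exists_seq_tendsto_ae hu (Nat.zero_le _)
  refine ⟨ns, hns, ?_⟩
  filter_upwards [hae, fn_mulBilin f g, ae_all_iff.2 fun i => fn_mulBilin f (u (ns i))]
    with t h1 h2 h3
  simp only [h2, h3, Pi.mul_apply]
  simp only [iteratedDerivWithin_zero] at h1
  exact h1.const_mul _

theorem continuous_mulBilin_left (g : SobolevSpace a b p (s + 1)) :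
    Continuous fun f : SobolevSpace a b p s => mulBilin f g := by
  refine continuous_of_seq_tendsto_ae (mulBilin.flip g) fun u f hu => ?_
  obtain ⟨ns, hns, hae⟩ := exists_seq_tendsto_ae hu (Nat.zero_le _)
  refine ⟨ns, hns, ?_⟩
  filter_upwards [hae, fn_mulBilin f g, ae_all_iff.2 fun i => fn_mulBilin (u (ns i)) g]
    with t h1 h2 h3
  simp only [LinearMap.flip_apply, h2, h3, Pi.mul_apply]
  simp only [iteratedDerivWithin_zero] at h1
  exact h1.mul_const _

/-- Pointwise multiplication `W_p^s × W_p^{s+1} → W_p^s` as a bounded bilinear map. Continuity in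
the first argument with respect to the operator norm follows from separate continuity, again by
the closed graph theorem. -/
noncomputable def mulL : SobolevSpace a b p s →L[ℂ] SobolevSpace a b p (s + 1) →L[ℂ]
    SobolevSpace a b p s :=
  let T : SobolevSpace a b p s →ₗ[ℂ] SobolevSpace a b p (s + 1) →L[ℂ] SobolevSpace a b p s :=
    { toFun := fun f => ⟨mulBilin f, continuous_mulBilin_right f⟩
      map_add' := fun f f' => by ext1 g; exact LinearMap.map_add₂ mulBilin f f' g
      map_smul' := fun c f => by ext1 g; exact LinearMap.map_smul₂ mulBilin c f g }
  { toLinearMap := T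
    cont := T.continuous_of_seq_closed_graph fun u f S hu hS => by
      ext1 g
      have h1 : Tendsto (fun i => mulBilin (u i) g) atTop (𝓝 (S g)) :=
        ((ContinuousLinearMap.apply ℂ _ g).continuous.tendsto S).comp hS
      exact tendsto_nhds_unique h1 (((continuous_mulBilin_left g).tendsto f).comp hu) }

theorem fn_mulL (f : SobolevSpace a b p s) (g : SobolevSpace a b p (s + 1)) :
    (mulL f g).fn =ᵐ[volume.restrict (Icc a b)] f.fn * g.fn :=
  fn_mulBilin f g

end SobolevSpace

end Continuity

/-! ### Dependence of the differential operator on its coefficients -/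

section DiffOp

open SobolevSpace

variable {a b : ℝ} [hab : Fact (a < b)] {p : ℝ≥0∞} [hp : Fact (1 ≤ p)] {n m r : ℕ}

theorem fn_diffOp (A : Fin r → Matrix (Fin m) (Fin m) (SobolevSpace a b p n))
    (y : SobolevVec a b p (n + r) m) (i : Fin m) :
    (diffOp A y i).fn =ᵐ[volume.restrict (Icc a b)] diffExpr A y i :=
  fn_mk _ (memSobolev_diffExpr A y i)

/-- The `i`-th component of `L y`, as a continuous operator. -/
noncomputable def diffOpComp (A : Fin r → Matrix (Fin m) (Fin m) (SobolevSpace a b p n))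
    (i : Fin m) : SobolevVec a b p (n + r) m →L[ℂ] SobolevSpace a b p n :=
  (derivL r le_rfl).comp (PiLp.proj 1 _ i) +
    ∑ j : Fin r, ∑ q : Fin m, (mulL (A j i q)).comp
      ((derivL (s' := n + 1) j (by omega)).comp (PiLp.proj 1 _ q))

theorem fn_sum {s : ℕ} {ι : Type*} (t : Finset ι) (F : ι → SobolevSpace a b p s) :
    (∑ i ∈ t, F i).fn =ᵐ[volume.restrict (Icc a b)] ∑ i ∈ t, (F i).fn := by
  classical
  induction t using Finset.induction_on with
  | empty => simpa using fn_zero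
  | insert i t hi ih =>
    rw [Finset.sum_insert hi, Finset.sum_insert hi]
    exact (fn_add _ _).trans ((EventuallyEq.refl _ _).add ih)

theorem diffOp_apply (A : Fin r → Matrix (Fin m) (Fin m) (SobolevSpace a b p n))
    (y : SobolevVec a b p (n + r) m) (i : Fin m) : diffOp A y i = diffOpComp A i y := by
  refine ext_fn ((fn_diffOp A y i).trans (EventuallyEq.symm ?_))
  have h1 : ∀ (j : Fin r) (q : Fin m),
      (mulL (A j i q) (derivL (s' := n + 1) j (by omega) (y q))).fn
        =ᵐ[volume.restrict (Icc a b)]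
      fun t => (A j i q).fn t * iteratedDerivWithin j (y q).fn (Icc a b) t := fun j q =>
    (fn_mulL _ _).trans ((EventuallyEq.refl _ _).mul (fn_derivL _ _ _))
  have h2 : diffOpComp A i y = derivL r le_rfl (y i) + ∑ j : Fin r, ∑ q : Fin m,
      mulL (A j i q) (derivL (s' := n + 1) j (by omega) (y q)) := by
    simp [diffOpComp]
  rw [h2]
  filter_upwards [fn_add (derivL r le_rfl (y i)) (∑ j : Fin r, ∑ q : Fin m,
      mulL (A j i q) (derivL (s' := n + 1) j (by omega) (y q))),
    fn_derivL r le_rfl (y i),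
    fn_sum Finset.univ fun j : Fin r => ∑ q : Fin m,
      mulL (A j i q) (derivL (s' := n + 1) j (by omega) (y q)),
    ae_all_iff.2 fun j : Fin r => fn_sum Finset.univ fun q : Fin m =>
      mulL (A j i q) (derivL (s' := n + 1) j (by omega) (y q)),
    ae_all_iff.2 fun j => ae_all_iff.2 (h1 j)] with t e1 e2 e3 e4 e5
  simp only [diffExpr, e1, Pi.add_apply, e2, e3, Finset.sum_apply, e4, e5]

/-- `diffOp A` as a continuous operator. -/
noncomputable def diffOpL (A : Fin r → Matrix (Fin m) (Fin m) (SobolevSpace a b p n)) :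
    SobolevVec a b p (n + r) m →L[ℂ] SobolevVec a b p n m :=
  ∑ i : Fin m, ((PiLp.continuousLinearEquiv 1 ℂ fun _ : Fin m => SobolevSpace a b p n).symm :
    _ →L[ℂ] _).comp ((ContinuousLinearMap.single ℂ (fun _ => SobolevSpace a b p n) i).comp
      (diffOpComp A i))

theorem diffOpL_toLinearMap (A : Fin r → Matrix (Fin m) (Fin m) (SobolevSpace a b p n)) :
    (diffOpL A).toLinearMap = diffOp A := by
  ext y i
  rw [diffOp_apply]
  simp [diffOpL, Finset.sum_apply, Pi.single_apply]

theorem tendsto_diffOpL {As : ℕ → Fin r → Matrix (Fin m) (Fin m) (SobolevSpace a b p n)}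
    {A : Fin r → Matrix (Fin m) (Fin m) (SobolevSpace a b p n)}
    (h : ∀ j i q, Tendsto (fun k => As k j i q) atTop (𝓝 (A j i q))) :
    Tendsto (fun k => diffOpL (As k)) atTop (𝓝 (diffOpL A)) := by
  refine tendsto_finsetSum _ fun i _ => ?_
  have hc : Tendsto (fun k => diffOpComp (As k) i) atTop (𝓝 (diffOpComp A i)) := by
    refine Tendsto.const_add _ (tendsto_finsetSum _ fun j _ => tendsto_finsetSum _ fun q _ => ?_)
    exact ((continuous_id.clm_comp continuous_const).tendsto _).comp
      ((mulL.continuous.tendsto _).comp (h j i q))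
  exact ((continuous_const.clm_comp (continuous_const.clm_comp continuous_id)).tendsto _).comp hc

/-- The monomial `(t - a)^j / j!`, as a complex-valued function. -/
noncomputable def monomialFn (a : ℝ) (j : ℕ) (t : ℝ) : ℂ :=
  ((t - a : ℝ) : ℂ) ^ j / (j.factorial : ℂ)

theorem hasDerivAt_monomialFn_succ (j : ℕ) (t : ℝ) :
    HasDerivAt (monomialFn a (j + 1)) (monomialFn a j t) t := by
  have h1 : HasDerivAt (fun t : ℝ => ((t - a : ℝ) : ℂ)) 1 t :=
    ((hasDerivAt_id t).sub_const a).ofReal_comp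
  have h2 := (h1.pow (j + 1)).div_const ((j + 1).factorial : ℂ)
  refine h2.congr_deriv ?_
  have : (j.factorial : ℂ) ≠ 0 := by exact_mod_cast j.factorial_ne_zero
  have : (j + 1 : ℂ) ≠ 0 := by exact_mod_cast j.succ_ne_zero
  simp only [monomialFn, Nat.factorial_succ]
  push_cast
  field_simp

theorem contDiff_monomialFn (j : ℕ) {k : WithTop ℕ∞} : ContDiff ℝ k (monomialFn a j) := by
  have h1 : ContDiff ℝ k fun t : ℝ => ((t - a : ℝ) : ℂ) :=
    Complex.ofRealCLM.contDiff.comp (contDiff_id.sub contDiff_const)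
  exact (h1.pow j).div_const _

theorem iteratedDerivWithin_monomialFn (i j : ℕ) :
    EqOn (iteratedDerivWithin i (monomialFn a (j + i)) (Icc a b)) (monomialFn a j) (Icc a b) := by
  induction i generalizing j with
  | zero => intro t _; simp
  | succ i ih =>
    intro t ht
    rw [iteratedDerivWithin_succ', ← ih j ht]
    refine iteratedDerivWithin_congr (fun t ht => ?_) ht
    exact (hasDerivAt_monomialFn_succ (j + i) t).hasDerivWithinAt.derivWithin
      (uniqueDiffOn_Icc hab.out t ht)

theorem iteratedDerivWithin_monomialFn_of_lt {i j : ℕ} (h : j < i) :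
    EqOn (iteratedDerivWithin i (monomialFn a j) (Icc a b)) 0 (Icc a b) := by
  induction j generalizing i with
  | zero =>
    intro t _
    have h0 : (monomialFn a 0 : ℝ → ℂ) = fun _ => 1 := by ext; simp [monomialFn]
    rw [h0, iteratedDerivWithin_const, if_neg (by omega)]
    rfl
  | succ j ih =>
    obtain ⟨i, rfl⟩ : ∃ k, i = k + 1 := ⟨i - 1, by omega⟩
    intro t ht
    rw [iteratedDerivWithin_succ', ← ih (by omega : j < i) ht]
    refine iteratedDerivWithin_congr (fun t ht => ?_) ht
    exact (hasDerivAt_monomialFn_succ j t).hasDerivWithinAt.derivWithin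
      (uniqueDiffOn_Icc hab.out t ht)

/-- The monomial `(t - a)^j / j!` as an element of `W_p^s`. -/
noncomputable def monomial (a b : ℝ) [hab : Fact (a < b)] (p : ℝ≥0∞) [hp : Fact (1 ≤ p)]
    (s j : ℕ) : SobolevSpace a b p s :=
  mk (monomialFn a j) (MemSobolev.of_contDiff hab.out s fun _ => contDiff_monomialFn j)

theorem derivL_monomial_of_lt {s s' i j : ℕ} (h : s' + i ≤ s) (hij : j < i) :
    derivL i h (monomial a b p s j) = 0 := by
  have hmem : MemSobolev a b p s (monomialFn a j) :=
    MemSobolev.of_contDiff hab.out s fun _ => contDiff_monomialFn j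
  refine ext_fn ((fn_derivL _ _ _).trans ?_)
  filter_upwards [MemSobolev.ae_congr hab.out (memSobolev_fn _) hmem (fn_mk _ hmem)
    (show i ≤ s by omega), fn_zero (a := a) (b := b) (p := p) (s := s'),
    ae_restrict_mem measurableSet_Icc] with t h1 h2 ht
  rw [h2]
  exact h1.trans (iteratedDerivWithin_monomialFn_of_lt hij ht)

theorem mulL_derivL_monomial_self {s s' j : ℕ} (h : s' + 1 + j ≤ s) (f : SobolevSpace a b p s') :
    mulL f (derivL j h (monomial a b p s j)) = f := by
  have hmem : MemSobolev a b p s (monomialFn a j) :=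
    MemSobolev.of_contDiff hab.out s fun _ => contDiff_monomialFn j
  refine ext_fn ((fn_mulL _ _).trans ?_)
  filter_upwards [fn_derivL j h (monomial a b p s j), MemSobolev.ae_congr hab.out
    (memSobolev_fn _) hmem (fn_mk _ hmem) (show j ≤ s by omega),
    ae_restrict_mem measurableSet_Icc] with t h0 h1 ht
  have h2 := iteratedDerivWithin_monomialFn (b := b) (a := a) j 0 ht
  rw [zero_add] at h2
  rw [Pi.mul_apply, h0, monomial, h1, h2]
  simp [monomialFn]

/-- The value of `L` on `(t - a)^j / j!` times a standard basis vector determines the coefficient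
`A_j` in terms of the others. The terms with `j' > j` are kept in the sum although they vanish. -/
theorem diffOp_monomial (A : Fin r → Matrix (Fin m) (Fin m) (SobolevSpace a b p n)) (j : Fin r)
    (i q : Fin m) :
    A j i q = diffOp A (WithLp.toLp 1 (Pi.single q (monomial a b p (n + r) j))) i -
      ∑ j' ∈ Finset.univ.erase j, mulL (A j' i q)
        (derivL (s' := n + 1) j' (by omega) (monomial a b p (n + r) j)) := by
  have h1 : derivL (s' := n) r le_rfl
      ((Pi.single q (monomial a b p (n + r) j) : Fin m → SobolevSpace a b p (n + r)) i) = 0 := by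
    rcases eq_or_ne i q with rfl | hne
    · rw [Pi.single_eq_same, derivL_monomial_of_lt _ j.2]
    · rw [Pi.single_eq_of_ne hne, map_zero]
  have h2 : ∀ j' : Fin r, ∑ x : Fin m, mulL (A j' i x) (derivL (s' := n + 1) j' (by omega)
      ((Pi.single q (monomial a b p (n + r) j) : Fin m → SobolevSpace a b p (n + r)) x)) =
      mulL (A j' i q) (derivL (s' := n + 1) j' (by omega) (monomial a b p (n + r) j)) := by
    intro j'
    rw [Finset.sum_eq_single q]
    · rw [Pi.single_eq_same]
    · intro x _ hx
      rw [Pi.single_eq_of_ne hx, map_zero, map_zero]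
    · simp
  rw [diffOp_apply]
  simp only [diffOpComp, add_apply, sum_apply,
    ContinuousLinearMap.comp_apply, PiLp.proj_apply, h1, h2, zero_add]
  rw [← Finset.add_sum_erase _ _ (Finset.mem_univ j), mulL_derivL_monomial_self, add_sub_cancel_right]

/-- Strong convergence of the differential operators forces convergence of their coefficients. -/
theorem tendsto_coeff {As : ℕ → Fin r → Matrix (Fin m) (Fin m) (SobolevSpace a b p n)}
    {A : Fin r → Matrix (Fin m) (Fin m) (SobolevSpace a b p n)}
    (h : ∀ y, Tendsto (fun k => diffOp (As k) y) atTop (𝓝 (diffOp A y))) (j : Fin r)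
    (i q : Fin m) : Tendsto (fun k => As k j i q) atTop (𝓝 (A j i q)) := by
  have key : ∀ N : ℕ, ∀ j : Fin r, (j : ℕ) = N →
      Tendsto (fun k => As k j i q) atTop (𝓝 (A j i q)) := by
    intro N
    induction N using Nat.strong_induction_on with
    | _ N ih =>
      rintro j rfl
      -- In the formula for `A j i q`, the terms with `j' < j` converge by induction and those with
      -- `j' > j` vanish.
      simp only [diffOp_monomial _ j i q]
      refine Tendsto.sub ?_ (tendsto_finsetSum _ fun j' hj' => ?_)
      · exact ((PiLp.proj (𝕜 := ℂ) 1 (fun _ => SobolevSpace a b p n) i).continuous.tendsto _).comp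
          (h _)
      · rcases lt_or_gt_of_ne (Fin.val_ne_of_ne (Finset.ne_of_mem_erase hj')) with hlt | hgt
        · exact ((mulL.flip _).continuous.tendsto _).comp (ih j' hlt j' rfl)
        · simp only [derivL_monomial_of_lt _ hgt, map_zero]
          exact tendsto_const_nhds
  exact key j j rfl

end DiffOp

/-! ### Linear systems with integrable coefficients -/

section Caratheodory

variable {a b : ℝ} {ι : Type*} [Fintype ι]

theorem intervalIntegrable_fun_sum {E : Type*} [NormedAddCommGroup E] {f : ι → ℝ → E}
    (h : ∀ i, IntervalIntegrable (f i) volume a b) :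
    IntervalIntegrable (fun s => ∑ i, f i s) volume a b := by
  simpa only [Finset.sum_fn] using IntervalIntegrable.sum Finset.univ fun i _ => h i

/-- `∫_a^t α e^{2β} = (e^{2β(t)} - 1) / 2` for `β = ∫ α`: the weight `e^{2β}` makes a Volterra
operator with kernel bounded by `α` a contraction with constant `1/2`. -/
theorem integral_mul_exp_primitive {α : ℝ → ℝ} (hab : a < b) (hα : IntervalIntegrable α volume a b)
    {t : ℝ} (ht : t ∈ Icc a b) :
    ∫ s in a..t, α s * Real.exp (2 * ∫ x in a..s, α x) =
      (Real.exp (2 * ∫ x in a..t, α x) - 1) / 2 := by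
  rcases eq_or_lt_of_le ht.1 with rfl | hat
  · simp
  have hα' : IntervalIntegrable α volume a t :=
    IntervalIntegrable.mono_Icc hab hα (left_mem_Icc.2 hab.le) ht
  have hβ := hα'.absolutelyContinuousOnInterval_intervalIntegral (c := a) left_mem_uIcc
  obtain ⟨R, hR⟩ := hβ.exists_bound
  -- `exp` is Lipschitz on the bounded range of `β`
  have hlip : LipschitzOnWith (Real.toNNReal (2 * Real.exp (2 * R)))
      (fun x => Real.exp (2 * x)) (Icc (-R) R) := by
    refine Convex.lipschitzOnWith_of_nnnorm_hasDerivWithin_le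
      (f' := fun x => Real.exp (2 * x) * 2) (convex_Icc _ _) (fun x _ => ?_) fun x hx => ?_
    · have := ((hasDerivAt_id x).const_mul 2).exp
      simpa using! this.hasDerivWithinAt
    · rw [← NNReal.coe_le_coe, Real.coe_toNNReal _ (by positivity), coe_nnnorm, Real.norm_eq_abs,
        abs_of_pos (by positivity), mul_comm]
      gcongr
      exact hx.2
  have hac : AbsolutelyContinuousOnInterval (fun s => Real.exp (2 * ∫ x in a..s, α x)) a t := by
    refine ac_of_dist_le (K := 2 * Real.exp (2 * R)) (by positivity) (fun x hx y hy => ?_) hβ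
    have := hlip.dist_le_mul _ (abs_le.1 (hR x hx)) _ (abs_le.1 (hR y hy))
    rwa [Real.coe_toNNReal _ (by positivity)] at this
  have h1 := hac.integral_deriv_eq_sub
  have h2 : ∫ s in a..t, deriv (fun s => Real.exp (2 * ∫ x in a..s, α x)) s =
      ∫ s in a..t, 2 * (α s * Real.exp (2 * ∫ x in a..s, α x)) := by
    refine intervalIntegral.integral_congr_ae ?_
    have h3 := ae_hasDerivAt_primitive hat hα'
    rw [ae_restrict_iff' measurableSet_Icc] at h3
    filter_upwards [h3] with s hs hsI
    rw [uIoc_of_le hat.le] at hsI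
    rw [((hs ⟨hsI.1.le, hsI.2⟩).const_mul 2).exp.deriv]
    ring
  rw [h2, intervalIntegral.integral_const_mul, intervalIntegral.integral_same, mul_zero,
    Real.exp_zero] at h1
  linarith

/-- The Cauchy problem `u' = M u + F`, `u(a) = c` for a linear system with integrable coefficients
has a unique solution. After the substitution `u = exp(2β) w` with `β(t) = ∫_a^t ∑ ‖M i j‖`, the
equivalent integral equation is a fixed point equation for a map with contraction constant `1/2`
in the supremum norm. -/
theorem existsUnique_linear_system (hab : a < b) {M : ι → ι → ℝ → ℂ} {F : ι → ℝ → ℂ} (c : ι → ℂ)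
    (hM : ∀ i j, IntervalIntegrable (M i j) volume a b)
    (hF : ∀ i, IntervalIntegrable (F i) volume a b) :
    ∃! u : C(Icc a b, ι → ℂ), ∀ (t : Icc a b) (i : ι), u t i = c i +
      ∫ s in a..(t : ℝ), (∑ j, M i j s * u (projIcc a b hab.le s) j + F i s) := by
  set α : ℝ → ℝ := fun s => ∑ i, ∑ j, ‖M i j s‖ with hα_def
  have hα : IntervalIntegrable α volume a b :=
    intervalIntegrable_fun_sum fun i => intervalIntegrable_fun_sum fun j => (hM i j).norm
  set β : ℝ → ℝ := fun t => ∫ x in a..t, α x with hβ_def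
  have hβc : ContinuousOn β (Icc a b) := by
    have := (hα.absolutelyContinuousOnInterval_intervalIntegral (c := a) left_mem_uIcc).continuousOn
    rwa [uIcc_of_le hab.le] at this
  -- multiplication by `exp (κ β)`
  let E : ℝ → C(Icc a b, ι → ℂ) → C(Icc a b, ι → ℂ) := fun κ w =>
    ⟨fun t i => (Real.exp (κ * β t) : ℂ) * w t i, by
      have h1 : Continuous fun t : Icc a b => β t := continuousOn_iff_continuous_domRestrict.1 hβc
      refine continuous_pi fun i => Continuous.mul ?_ ((continuous_apply i).comp w.continuous)
      exact Complex.continuous_ofReal.comp (Real.continuous_exp.comp (continuous_const.mul h1))⟩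
  have hE : ∀ κ w, E (-κ) (E κ w) = w := fun κ w => by
    ext t i
    change (Real.exp (-κ * β t) : ℂ) * ((Real.exp (κ * β t) : ℂ) * w t i) = w t i
    rw [← mul_assoc, ← Complex.ofReal_mul, ← Real.exp_add]
    simp
  have hint : ∀ (u : C(Icc a b, ι → ℂ)) i, IntervalIntegrable
      (fun s => ∑ j, M i j s * u (projIcc a b hab.le s) j + F i s) volume a b := by
    intro u i
    refine IntervalIntegrable.add (intervalIntegrable_fun_sum fun j => ?_) (hF i)
    refine (hM i j).mul_continuousOn (Continuous.continuousOn ?_)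
    have h1 : Continuous (projIcc a b hab.le) := continuous_projIcc
    fun_prop
  let V : C(Icc a b, ι → ℂ) → C(Icc a b, ι → ℂ) := fun u =>
    ⟨fun t i => c i + ∫ s in a..(t : ℝ), (∑ j, M i j s * u (projIcc a b hab.le s) j + F i s), by
      refine continuous_pi fun i => continuous_const.add ?_
      exact continuousOn_iff_continuous_domRestrict.1
        (ac_continuousOn hab (ac_primitive hab (hint u i)))⟩
  have hV : ∀ u : C(Icc a b, ι → ℂ), (∀ (t : Icc a b) (i : ι), u t i = c i +
      ∫ s in a..(t : ℝ), (∑ j, M i j s * u (projIcc a b hab.le s) j + F i s)) ↔ V u = u := by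
    intro u
    constructor
    · intro h
      ext t i
      exact (h t i).symm
    · intro h t i
      exact (congrArg (fun v : C(Icc a b, ι → ℂ) => v t i) h).symm
  have hcontr : ContractingWith (1 / 2) fun w => E (-2) (V (E 2 w)) := by
    refine ⟨by norm_num, LipschitzWith.of_dist_le_mul fun w v => ?_⟩
    refine (ContinuousMap.dist_le (by positivity)).2 fun t =>
      (dist_pi_le_iff (by positivity)).2 fun i => ?_
    have hsub : (E (-2) (V (E 2 w))) t i - (E (-2) (V (E 2 v))) t i =
        (Real.exp (-2 * β t) : ℂ) * ∫ s in a..(t : ℝ), ∑ j, M i j s *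
          ((Real.exp (2 * β (projIcc a b hab.le s)) : ℂ) *
            (w (projIcc a b hab.le s) j - v (projIcc a b hab.le s) j)) := by
      have hi := fun u => IntervalIntegrable.mono_Icc hab (hint u i) (left_mem_Icc.2 hab.le) t.2
      change (Real.exp (-2 * β t) : ℂ) * (c i + _) - (Real.exp (-2 * β t) : ℂ) * (c i + _) = _
      rw [← mul_sub, add_sub_add_left_eq_sub,
        ← intervalIntegral.integral_sub (hi (E 2 w)) (hi (E 2 v))]
      congr 2
      ext s
      rw [add_sub_add_right_eq_sub, ← Finset.sum_sub_distrib]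
      refine Finset.sum_congr rfl fun j _ => ?_
      rw [mul_sub, mul_sub]
      rfl
    have hbound : ‖∫ s in a..(t : ℝ), ∑ j, M i j s *
        ((Real.exp (2 * β (projIcc a b hab.le s)) : ℂ) *
          (w (projIcc a b hab.le s) j - v (projIcc a b hab.le s) j))‖ ≤
        ∫ s in a..(t : ℝ), (α s * Real.exp (2 * β s)) * dist w v := by
      refine intervalIntegral.norm_integral_le_of_norm_le t.2.1
        (Eventually.of_forall fun s hs => ?_) ?_
      · have hsI : s ∈ Icc a b := ⟨hs.1.le, hs.2.trans t.2.2⟩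
        rw [projIcc_of_mem hab.le hsI]
        calc ‖∑ j, M i j s * ((Real.exp (2 * β s) : ℂ) * (w ⟨s, hsI⟩ j - v ⟨s, hsI⟩ j))‖
            ≤ ∑ j, ‖M i j s‖ * (Real.exp (2 * β s) * dist w v) := by
              refine norm_sum_le_of_le _ fun j _ => ?_
              rw [norm_mul, norm_mul, Complex.norm_real, Real.norm_eq_abs, Real.abs_exp,
                ← dist_eq_norm]
              gcongr
              exact (dist_le_pi_dist _ _ j).trans (ContinuousMap.dist_apply_le_dist _)
          _ = (∑ j, ‖M i j s‖) * (Real.exp (2 * β s) * dist w v) := by rw [Finset.sum_mul]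
          _ ≤ α s * (Real.exp (2 * β s) * dist w v) := by
              gcongr
              exact Finset.single_le_sum (f := fun i => ∑ j, ‖M i j s‖)
                (fun i _ => Finset.sum_nonneg fun j _ => norm_nonneg _) (Finset.mem_univ i)
          _ = _ := by ring
      · refine IntervalIntegrable.mono_Icc hab ?_ (left_mem_Icc.2 hab.le) t.2
        refine (hα.mul_continuousOn ?_).mul_const _
        rw [uIcc_of_le hab.le]
        fun_prop
    rw [dist_eq_norm, hsub, norm_mul, Complex.norm_real, Real.norm_eq_abs, Real.abs_exp]
    refine (mul_le_mul_of_nonneg_left hbound (Real.exp_pos _).le).trans ?_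
    rw [intervalIntegral.integral_mul_const, integral_mul_exp_primitive hab hα t.2, ← mul_assoc]
    push_cast
    gcongr
    have h1 : Real.exp (-2 * β t) * Real.exp (2 * β t) = 1 := by
      rw [← Real.exp_add]; simp
    change Real.exp (-2 * β t) * ((Real.exp (2 * β t) - 1) / 2) ≤ 1 / 2
    nlinarith [Real.exp_pos (-2 * β t)]
  -- `E 2` and `E (-2)` are inverse to each other and translate fixed points into solutions.
  have hE' : ∀ w, E 2 (E (-2) w) = w := fun w => by simpa using hE (-2) w
  refine ⟨E 2 (hcontr.fixedPoint _), (hV _).2 ?_, fun u hu => ?_⟩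
  · have h1 : E (-2) (V (E 2 (hcontr.fixedPoint _))) = hcontr.fixedPoint _ :=
      hcontr.fixedPoint_isFixedPt
    conv_rhs => rw [← h1]
    rw [hE']
  · have h1 : Function.IsFixedPt (fun w => E (-2) (V (E 2 w))) (E (-2) u) := by
      change E (-2) (V (E 2 (E (-2) u))) = E (-2) u
      rw [hE', (hV u).1 hu]
    rw [← hcontr.fixedPoint_unique h1, hE']

end Caratheodory

/-! ### The Cauchy problem for the differential operator -/

section CauchyProblem

open SobolevSpace

/-- For positive order, the Sobolev class is closed under multiplication. -/
theorem MemSobolev.mul_succ {a b : ℝ} {p : ℝ≥0∞} {s : ℕ} {f g : ℝ → ℂ} (hab : a < b)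
    (hf : MemSobolev a b p (s + 1) f) (hg : MemSobolev a b p (s + 1) g) :
    MemSobolev a b p (s + 1) (f * g) := by
  cases s with
  | zero =>
    have hf1 : AbsolutelyContinuousOnInterval f a b := by simpa using hf.2.1
    have hg1 : AbsolutelyContinuousOnInterval g a b := by simpa using hg.2.1
    have hf2 : MemLp (derivWithin f (Icc a b)) p (volume.restrict (Icc a b)) := by
      simpa [iteratedDerivWithin_one] using hf.2.2
    have hg2 : MemLp (derivWithin g (Icc a b)) p (volume.restrict (Icc a b)) := by
      simpa [iteratedDerivWithin_one] using hg.2.2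
    refine ⟨hf.1.mul hg.1, by simpa using! hf1.smul hg1, ?_⟩
    refine ((memLp_mul hf2 hg.continuousOn).add (memLp_mul hg2 hf.continuousOn)).ae_eq ?_
    filter_upwards [ac_ae_diff hab hf1, ac_ae_diff hab hg1] with x h1 h2
    rw [zero_add, iteratedDerivWithin_one, derivWithin_mul h1 h2]
    simp only [Pi.add_apply, Pi.mul_apply]
    ring
  | succ s =>
    have h1 := hf
    have h2 := hg
    rw [succ_succ_iff hab] at h1 h2 ⊢
    refine ⟨h1.1.mul h2.1, MemSobolev.congr hab (fun x hx => ?_)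
      ((h1.2.mul hab hg).add hab (h2.2.mul hab hf))⟩
    rw [derivWithin_mul (h1.1 x hx) (h2.1 x hx)]
    simp only [Pi.add_apply, Pi.mul_apply]
    ring

variable {a b : ℝ} [hab : Fact (a < b)] {p : ℝ≥0∞} [hp : Fact (1 ≤ p)] {n m r : ℕ}

/-- The block companion matrix of `L`: with `u = (y, y', …, y^(r-1))`, the equation `L y = f` is the
first-order system `u' = companion A u + (0, …, 0, f)`. -/
noncomputable def companion (A : Fin r → Matrix (Fin m) (Fin m) (SobolevSpace a b p n))
    (x y : Fin r × Fin m) (t : ℝ) : ℂ :=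
  if (x.1 : ℕ) + 1 < r then if (y.1 : ℕ) = x.1 + 1 ∧ y.2 = x.2 then 1 else 0
  else -(A y.1 x.2 y.2).fn t

theorem sum_companion_of_lt (A : Fin r → Matrix (Fin m) (Fin m) (SobolevSpace a b p n))
    {j : ℕ} (h : j + 1 < r) (i : Fin m) (t : ℝ) (u : Fin r × Fin m → ℂ) :
    ∑ y, companion A (⟨j, by omega⟩, i) y t * u y = u (⟨j + 1, h⟩, i) := by
  rw [Finset.sum_eq_single (⟨j + 1, h⟩, i)]
  · simp [companion, h]
  · rintro ⟨k, q⟩ _ hne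
    simp only [companion, h, if_true]
    rw [if_neg, zero_mul]
    rintro ⟨h1, h2⟩
    exact hne (Prod.ext (Fin.ext h1) h2)
  · simp

theorem sum_companion_last (A : Fin r → Matrix (Fin m) (Fin m) (SobolevSpace a b p n))
    {j : ℕ} (hj : j < r) (h : ¬ j + 1 < r) (i : Fin m) (t : ℝ) (u : Fin r × Fin m → ℂ) :
    ∑ y, companion A (⟨j, hj⟩, i) y t * u y =
      -∑ k : Fin r, ∑ q : Fin m, (A k i q).fn t * u (k, q) := by
  rw [Fintype.sum_prod_type, ← Finset.sum_neg_distrib]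
  refine Finset.sum_congr rfl fun k _ => ?_
  rw [← Finset.sum_neg_distrib]
  refine Finset.sum_congr rfl fun q _ => ?_
  simp [companion, h]

theorem memSobolev_companion (A : Fin r → Matrix (Fin m) (Fin m) (SobolevSpace a b p n))
    (x y : Fin r × Fin m) : MemSobolev a b p n (companion A x y) := by
  by_cases h : (x.1 : ℕ) + 1 < r
  · have h1 : companion A x y =
        fun _ => if (y.1 : ℕ) = x.1 + 1 ∧ y.2 = x.2 then (1 : ℂ) else 0 := by
      ext t; simp [companion, h]
    rw [h1]
    exact MemSobolev.of_contDiff hab.out n fun _ => contDiff_const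
  · have h1 : companion A x y = (-1 : ℂ) • (A y.1 x.2 y.2).fn := by
      ext t; simp [companion, h]
    rw [h1]
    exact (memSobolev_fn _).const_smul _

theorem intervalIntegrable_companion (A : Fin r → Matrix (Fin m) (Fin m) (SobolevSpace a b p n))
    (x y : Fin r × Fin m) : IntervalIntegrable (companion A x y) volume a b :=
  intervalIntegrable_of_memLp hab.out hp.out (by
    simpa using (memSobolev_companion A x y).memLp_iteratedDerivWithin hab.out (Nat.zero_le n))

/-- Regularity: continuous solutions of a first-order system have one more order of smoothness than
the coefficients, by bootstrapping in the integral equation. -/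
theorem memSobolev_of_linear_system {ι : Type*} [Fintype ι] {M : ι → ι → ℝ → ℂ} {F U : ι → ℝ → ℂ}
    {c : ι → ℂ} (hM : ∀ x y, MemSobolev a b p n (M x y)) (hF : ∀ x, MemSobolev a b p n (F x))
    (hU : ∀ x, ContinuousOn (U x) (Icc a b))
    (h : ∀ x, ∀ t ∈ Icc a b, U x t = c x + ∫ s in a..t, (∑ y, M x y s * U y s + F x s)) (x : ι) :
    MemSobolev a b p (n + 1) (U x) := by
  have step : ∀ s ≤ n, (∀ x y, MemSobolev a b p s (M x y * U y)) →
      ∀ x, MemSobolev a b p (s + 1) (U x) := by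
    intro s hs hMU x
    refine MemSobolev.of_eq_primitive hab.out hp.out (c := c x) (g := ∑ y, M x y * U y + F x)
      (MemSobolev.add hab.out (MemSobolev.sum hab.out _ fun y _ => hMU x y)
        ((hF x).of_le hab.out hs)) fun t ht => ?_
    simpa using h x t ht
  have key : ∀ s ≤ n, ∀ x, MemSobolev a b p (s + 1) (U x) := by
    intro s
    induction s with
    | zero =>
      exact fun hs => step 0 hs fun x y =>
        MemSobolev.memLp_mul ((hM x y).of_le hab.out hs) (hU y)
    | succ s ih =>
      exact fun hs => step (s + 1) hs fun x y =>
        ((hM x y).of_le hab.out hs).mul_succ hab.out (ih (by omega) y)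
  exact key n le_rfl x

/-- Solve the companion system with zero initial values; the first block of components of the
solution is a preimage. Its components `u_j` satisfy `u_j' = u_{j+1}`, so that the regularity
`W_p^{n+1}` of the last block improves by one order with each step down to `u_0 ∈ W_p^{n+r}`. -/
theorem surjective_diffOp (hr : 1 ≤ r)
    (A : Fin r → Matrix (Fin m) (Fin m) (SobolevSpace a b p n)) :
    Function.Surjective (diffOp A) := by
  intro f
  let F : Fin r × Fin m → ℝ → ℂ := fun x => if (x.1 : ℕ) + 1 < r then 0 else (f x.2).fn
  have hF : ∀ x, MemSobolev a b p n (F x) := by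
    intro x
    by_cases h : (x.1 : ℕ) + 1 < r
    · simp only [F, h, if_true]; exact MemSobolev.zero
    · simp only [F, h, if_false]; exact memSobolev_fn _
  obtain ⟨u, hu, -⟩ := existsUnique_linear_system hab.out (M := companion A) (F := F) 0
    (intervalIntegrable_companion A) fun x => intervalIntegrable_of_memLp hab.out hp.out
      (by simpa using (hF x).memLp_iteratedDerivWithin hab.out (Nat.zero_le n))
  let U : Fin r × Fin m → ℝ → ℂ := fun x t => u (projIcc a b hab.out.le t) x
  have hUc : ∀ x, Continuous (U x) := fun x =>
    (continuous_apply x).comp (u.continuous.comp continuous_projIcc)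
  have hU : ∀ x, ∀ t ∈ Icc a b, U x t = (0 : ℂ) +
      ∫ s in a..t, (∑ y, companion A x y s * U y s + F x s) := by
    intro x t ht
    have := hu ⟨t, ht⟩ x
    simp only [U, projIcc_of_mem hab.out.le ht]
    exact this
  have hlt : ∀ (j : ℕ) (h : j + 1 < r) (i : Fin m), ∀ t ∈ Icc a b,
      U (⟨j, by omega⟩, i) t = 0 + ∫ s in a..t, U (⟨j + 1, h⟩, i) s := by
    intro j h i t ht
    rw [hU _ t ht]
    congr 2
    ext s
    rw [sum_companion_of_lt A h]
    simp [F, h]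
  have hlast : ∀ (j : ℕ) (hj : j < r) (h : ¬ j + 1 < r) (i : Fin m), ∀ t ∈ Icc a b,
      U (⟨j, hj⟩, i) t = 0 + ∫ s in a..t,
        (-∑ k : Fin r, ∑ q : Fin m, (A k i q).fn s * U (k, q) s + (f i).fn s) := by
    intro j hj h i t ht
    rw [hU _ t ht]
    congr 2
    ext s
    rw [sum_companion_last A hj h i s fun y => U y s]
    simp [F, h]
  have hreg : ∀ (d j : ℕ) (h : j + d + 1 = r) (i : Fin m),
      MemSobolev a b p (n + 1 + d) (U (⟨j, by omega⟩, i)) := by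
    intro d
    induction d with
    | zero =>
      exact fun j h i => memSobolev_of_linear_system (c := 0) (memSobolev_companion A) hF
        (fun x => (hUc x).continuousOn) hU _
    | succ d ih =>
      intro j h i
      exact MemSobolev.of_eq_primitive hab.out hp.out (ih (j + 1) (by omega) i)
        (hlt j (by omega) i)
  have hmem : ∀ i, MemSobolev a b p (n + r) (U (⟨0, hr⟩, i)) := by
    intro i
    have := hreg (r - 1) 0 (by omega) i
    rwa [show n + 1 + (r - 1) = n + r by omega] at this
  have hder : ∀ (j : ℕ) (h : j < r) (i : Fin m),
      EqOn (iteratedDerivWithin j (U (⟨0, hr⟩, i)) (Icc a b)) (U (⟨j, h⟩, i)) (Icc a b) := by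
    intro j
    induction j with
    | zero => intro h i t _; simp
    | succ j ih =>
      intro h i t ht
      rw [iteratedDerivWithin_succ, derivWithin_congr (ih (by omega) i) (ih (by omega) i ht)]
      exact (hasDerivWithinAt_of_eq_primitive hab.out (hUc _).continuousOn (hlt j h i)
        ht).derivWithin (uniqueDiffOn_Icc hab.out t ht)
  have htop : ∀ i : Fin m, iteratedDerivWithin r (U (⟨0, hr⟩, i)) (Icc a b)
      =ᵐ[volume.restrict (Icc a b)] fun s =>
        -∑ k : Fin r, ∑ q : Fin m, (A k i q).fn s * U (k, q) s + (f i).fn s := by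
    intro i
    obtain ⟨j, rfl⟩ : ∃ j, r = j + 1 := ⟨r - 1, by omega⟩
    have hint : IntervalIntegrable (fun s => -∑ k : Fin (j + 1), ∑ q : Fin m,
        (A k i q).fn s * U (k, q) s + (f i).fn s) volume a b := by
      have hfn : ∀ g : SobolevSpace a b p n, IntervalIntegrable g.fn volume a b := fun g =>
        intervalIntegrable_of_memLp hab.out hp.out (by
          simpa using g.memSobolev_fn.memLp_iteratedDerivWithin hab.out (Nat.zero_le n))
      exact (intervalIntegrable_fun_sum fun k => intervalIntegrable_fun_sum fun q =>
        (hfn (A k i q)).mul_continuousOn (hUc (k, q)).continuousOn).neg.add (hfn (f i))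
    filter_upwards [derivWithin_ae_eq_of_eq_primitive hab.out hint
      (hlast j (by omega) (by omega) i), ae_restrict_mem measurableSet_Icc] with t h1 ht
    rw [iteratedDerivWithin_succ, derivWithin_congr (hder j (by omega) i) (hder j (by omega) i ht),
      h1]
  refine ⟨WithLp.toLp 1 fun i => mk (U (⟨0, hr⟩, i)) (hmem i),
    PiLp.ext fun i => ext_fn ((fn_diffOp A _ i).trans ?_)⟩
  have hmk : ∀ (j : Fin (r + 1)) (q : Fin m),
      iteratedDerivWithin j (mk (U (⟨0, hr⟩, q)) (hmem q)).fn (Icc a b)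
        =ᵐ[volume.restrict (Icc a b)] iteratedDerivWithin j (U (⟨0, hr⟩, q)) (Icc a b) :=
    fun j q => MemSobolev.ae_congr hab.out (memSobolev_fn _) (hmem q) (fn_mk _ (hmem q)) (by omega)
  filter_upwards [htop i, ae_all_iff.2 fun j => ae_all_iff.2 (hmk j),
    ae_restrict_mem measurableSet_Icc] with t h1 h2 ht
  have h3 : iteratedDerivWithin r (mk (U (⟨0, hr⟩, i)) (hmem i)).fn (Icc a b) t = _ :=
    h2 (Fin.last r) i
  have h4 : ∀ (j : Fin r) (q : Fin m),
      iteratedDerivWithin j (mk (U (⟨0, hr⟩, q)) (hmem q)).fn (Icc a b) t = U (j, q) t :=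
    fun j q => (h2 j.castSucc q).trans (hder j j.2 q ht)
  simp only [diffExpr, h3, h4]
  rw [Fin.val_last, h1]
  ring

theorem continuousOn_iteratedDerivWithin_fn {s j : ℕ} (F : SobolevSpace a b p s) (hj : j < s) :
    ContinuousOn (iteratedDerivWithin j F.fn (Icc a b)) (Icc a b) :=
  (memSobolev_iteratedDerivWithin_fn (s' := s - j - 1 + 1) F (by omega)).continuousOn

theorem eqOn_Icc_of_ae_eq_restrict {f g : ℝ → ℂ} (hf : ContinuousOn f (Icc a b))
    (hg : ContinuousOn g (Icc a b)) (h : f =ᵐ[volume.restrict (Icc a b)] g) :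
    EqOn f g (Icc a b) :=
  Measure.eqOn_Icc_of_ae_eq volume hab.out.ne h hf hg

/-- The initial values `(y(a), y'(a), …, y^(r-1)(a))`. -/
noncomputable def initialValues (a b : ℝ) [hab : Fact (a < b)] (p : ℝ≥0∞) [hp : Fact (1 ≤ p)]
    (n m r : ℕ) : SobolevVec a b p (n + r) m →ₗ[ℂ] (Fin r × Fin m → ℂ) where
  toFun y x := iteratedDerivWithin x.1 (y x.2).fn (Icc a b) a
  map_add' y z := by
    ext ⟨j, q⟩
    refine eqOn_Icc_of_ae_eq_restrict (continuousOn_iteratedDerivWithin_fn _ (by omega))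
      ((continuousOn_iteratedDerivWithin_fn _ (by omega)).add
        (continuousOn_iteratedDerivWithin_fn _ (by omega)))
      (deriv_fn_add (y q) (z q) j (by omega)) (left_mem_Icc.2 hab.out.le)
  map_smul' c y := by
    ext ⟨j, q⟩
    refine eqOn_Icc_of_ae_eq_restrict (continuousOn_iteratedDerivWithin_fn _ (by omega))
      ((continuousOn_iteratedDerivWithin_fn _ (by omega)).const_smul c)
      (deriv_fn_smul c (y q) j (by omega)) (left_mem_Icc.2 hab.out.le)

/-- Uniqueness for the Cauchy problem: `(y, y', …, y^(r-1))` and `0` both solve the homogeneous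
companion system with zero initial values. -/
theorem eq_zero_of_diffOp_eq_zero (hr : 1 ≤ r)
    {A : Fin r → Matrix (Fin m) (Fin m) (SobolevSpace a b p n)}
    {y : SobolevVec a b p (n + r) m} (hy : diffOp A y = 0)
    (h0 : initialValues a b p n m r y = 0) : y = 0 := by
  let Y : Fin r × Fin m → ℝ → ℂ := fun x => iteratedDerivWithin x.1 (y x.2).fn (Icc a b)
  have hYc : ∀ x, ContinuousOn (Y x) (Icc a b) := fun x =>
    continuousOn_iteratedDerivWithin_fn _ (by omega)
  let u : C(Icc a b, Fin r × Fin m → ℂ) :=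
    ⟨fun t x => Y x t, continuous_pi fun x => continuousOn_iff_continuous_domRestrict.1 (hYc x)⟩
  have hsys : ∀ x, derivWithin (Y x) (Icc a b) =ᵐ[volume.restrict (Icc a b)]
      fun s => ∑ z, companion A x z s * u (projIcc a b hab.out.le s) z + 0 := by
    rintro ⟨⟨j, hj⟩, i⟩
    by_cases h : j + 1 < r
    · filter_upwards [ae_restrict_mem measurableSet_Icc] with t ht
      rw [sum_companion_of_lt A h, projIcc_of_mem hab.out.le ht, add_zero]
      exact (congrFun (iteratedDerivWithin_succ (n := j)) t).symm
    · have h1 : (diffOp A y i).fn =ᵐ[volume.restrict (Icc a b)] 0 := by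
        rw [hy]; exact fn_zero
      filter_upwards [h1.symm.trans (fn_diffOp A y i), ae_restrict_mem measurableSet_Icc]
        with t h2 ht
      rw [sum_companion_last A hj h, projIcc_of_mem hab.out.le ht, add_zero]
      have h3 : derivWithin (Y (⟨j, hj⟩, i)) (Icc a b) t =
          iteratedDerivWithin r (y i).fn (Icc a b) t := by
        obtain rfl : r = j + 1 := by omega
        exact (congrFun (iteratedDerivWithin_succ (n := j)) t).symm
      rw [h3]
      exact eq_neg_of_add_eq_zero_left h2.symm
  have hu : ∀ (t : Icc a b) (x : Fin r × Fin m), u t x = (0 : Fin r × Fin m → ℂ) x +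
      ∫ s in a..(t : ℝ), (∑ z, companion A x z s * u (projIcc a b hab.out.le s) z + 0) := by
    intro t x
    have hmem : MemSobolev a b p (n + r - x.1 - 1 + 1) (Y x) :=
      memSobolev_iteratedDerivWithin_fn _ (by omega)
    have h1 := hmem.eq_add_integral_derivWithin hab.out hp.out t t.2
    rw [integral_congr_restrict (hsys x) t.2] at h1
    have h2 : Y x a = 0 := congrFun h0 x
    rw [h2] at h1
    exact h1
  have hzero : ∀ (t : Icc a b) (x : Fin r × Fin m),
      (0 : C(Icc a b, Fin r × Fin m → ℂ)) t x = (0 : Fin r × Fin m → ℂ) x +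
      ∫ s in a..(t : ℝ), (∑ z, companion A x z s *
        (0 : C(Icc a b, Fin r × Fin m → ℂ)) (projIcc a b hab.out.le s) z + 0) := by
    intro t x
    simp
  have huz : u = 0 := (existsUnique_linear_system hab.out (M := companion A)
    (F := fun _ _ => 0) 0 (intervalIntegrable_companion A) fun _ =>
      intervalIntegrable_const).unique hu hzero
  refine PiLp.ext fun i => ext_fn ?_
  filter_upwards [fn_zero (a := a) (b := b) (p := p) (s := n + r),
    ae_restrict_mem measurableSet_Icc] with t h1 ht
  have h2 : Y (⟨0, hr⟩, i) t = 0 :=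
    congrArg (fun v : C(Icc a b, Fin r × Fin m → ℂ) => v ⟨t, ht⟩ (⟨0, hr⟩, i)) huz
  simp only [Y, iteratedDerivWithin_zero] at h2
  rw [h2]
  exact h1.symm

theorem finiteDimensional_ker_diffOp (hr : 1 ≤ r)
    (A : Fin r → Matrix (Fin m) (Fin m) (SobolevSpace a b p n)) :
    FiniteDimensional ℂ (LinearMap.ker (diffOp A)) := by
  refine Module.Finite.of_injective
    (initialValues a b p n m r ∘ₗ (LinearMap.ker (diffOp A)).subtype) ?_
  rw [← LinearMap.ker_eq_bot, LinearMap.ker_eq_bot']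
  exact fun y hy => Subtype.ext (eq_zero_of_diffOp_eq_zero hr y.2 hy)

end CauchyProblem

end SobolevBVP

theorem theorem4 (a b : ℝ) [Fact (a < b)] (p : ENNReal) [Fact (1 ≤ p)]
    (n m r l : ℕ) (hm : 1 ≤ m) (hr : 1 ≤ r) (hl : 1 ≤ l)
    (A : Fin r → Matrix (Fin m) (Fin m) (SobolevBVP.SobolevSpace a b p n))
    (B : SobolevBVP.SobolevVec a b p (n + r) m →L[ℂ] (Fin l → ℂ))
    (Aseq : ℕ → Fin r → Matrix (Fin m) (Fin m) (SobolevBVP.SobolevSpace a b p n))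
    (Bseq : ℕ → SobolevBVP.SobolevVec a b p (n + r) m →L[ℂ] (Fin l → ℂ))
    (hconv : SobolevBVP.StronglyConverges
      (fun k => SobolevBVP.bvpOp (Aseq k) (Bseq k)) (SobolevBVP.bvpOp A B)) :
    ∀ᶠ k in Filter.atTop,
      SobolevBVP.dimKer (SobolevBVP.bvpOp (Aseq k) (Bseq k)) ≤
          SobolevBVP.dimKer (SobolevBVP.bvpOp A B) ∧
        SobolevBVP.dimCoker (SobolevBVP.bvpOp (Aseq k) (Bseq k)) ≤
          SobolevBVP.dimCoker (SobolevBVP.bvpOp A B) := by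
  -- Strong convergence of the pair gives norm convergence of the differential operators, but only
  -- pointwise convergence of the boundary operators.
  have hA := SobolevBVP.tendsto_diffOpL (SobolevBVP.tendsto_coeff fun y =>
    (continuous_fst.tendsto _).comp (hconv y))
  have hB : ∀ y, Tendsto (fun k => Bseq k y) atTop (𝓝 (B y)) := fun y =>
    (continuous_snd.tendsto _).comp (hconv y)
  have hfin := SobolevBVP.finiteDimensional_ker_diffOp hr A
  have hsurj := SobolevBVP.surjective_diffOp hr A
  rw [← SobolevBVP.diffOpL_toLinearMap] at hfin hsurj
  have hbvp : ∀ A (B : SobolevBVP.SobolevVec a b p (n + r) m →L[ℂ] (Fin l → ℂ)),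
      SobolevBVP.bvpOp A B = (SobolevBVP.diffOpL A).toLinearMap.prod B.toLinearMap := fun A B => by
    rw [SobolevBVP.diffOpL_toLinearMap, SobolevBVP.bvpOp]
  simp only [hbvp]
  exact SobolevBVP.eventually_rank_le _ B _ Bseq hsurj hfin hA hB
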